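/- Let $X$ be an infinite compact metric space, $\phi : X \to X$ a minimal homeomorphism (every orbit $\{\phi^n(x) : n \in \mathbb Z\}$ is dense), $F : X \to \mathbb R$ a continuous function and $\beta \in \mathbb R \setminus \{0\}$. Let $C(X) \rtimes_\phi \mathbb Z$ be the crossed product, i.e. the universal $C^*$-algebra generated by a copy of $C(X)$ and a unitary $U$ with $U f U^* = f \circ \phi^{-1}$ for $f \in C(X)$; let $E : C(X) \rtimes_\phi \mathbb Z \to C(X)$ be the canonical conditional expectation, with $E(f) = f$ and $E(f U^n) = 0$ for $f \in C(X)$, $n \neq 0$; and let $\alpha^F = \{\alpha^F_t\}_{t \in \mathbb R}$ be the flow on $C(X) \rtimes_\phi \mathbb Z$ determined by $\alpha^F_t(fU) = f U e^{-itF}$ for $f \in C(X)$. A state $\omega$ on $C(X) \rtimes_\phi \mathbb Z$ is a $\beta$-KMS state for $\alpha^F$ when $\omega(ab) = \omega(b\,\alpha^F_{i\beta}(a))$ for all $a, b$ in a dense $\alpha^F$-invariant $*$-algebra of $\alpha^F$-analytic elements. An $e^{\beta F}$-conformal measure is a Borel probability measure $m$ on $X$ with $m(\phi(B)) = \int_B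 e^{\beta F} \, \mathrm{d}m$ for all Borel sets $B \subseteq X$. Then the set of $\beta$-KMS states for $\alpha^F$ is convex, and for every $\beta$-KMS state $\omega$ there is a unique $e^{\beta F}$-conformal measure $m_\omega$ with $\omega(f) = \int_X f \, \mathrm{d}m_\omega$ for all $f \in C(X)$. The map $\omega \mapsto m_\omega$ is an affine homeomorphism from the set of $\beta$-KMS states for $\alpha^F$ (with the weak$^*$ topology) onto the set of $e^{\beta F}$-conformal measures (with the topology of weak convergence), and its inverse sends $m$ to the state $a \mapsto \int_X E(a) \, \mathrm{d}m$. -/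

import Mathlib

open MeasureTheory
open scoped ENNReal ComplexOrder

universe u w

noncomputable section

namespace KMSCrossed

/-- The bounded product of a family of nonzero unital C⋆-algebras is a unital C⋆-algebra. -/
instance boundedProductCStarAlgebra {I : Type*} {A : I → Type*} [∀ i, CStarAlgebra (A i)]
    [∀ i, Nontrivial (A i)] : CStarAlgebra (lp A ∞) where

section CrossedProduct

variable {X : Type u} [TopologicalSpace X] [CompactSpace X]

/-- A covariant pair `(π, V)` in a nonzero unital C⋆-algebra `B` of the universe of `X`: a unital
`⋆`-homomorphism `π : C(X) → B` and a unitary `V ∈ B` with `V π(f) V⋆ = π(f ∘ φ⁻¹)`. -/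
structure CovariantRep (φ : X ≃ₜ X) : Type (u + 1) where
  B : Type u
  [cstar : CStarAlgebra B]
  [nontriv : Nontrivial B]
  π : C(X, ℂ) →⋆ₐ[ℂ] B
  V : unitary B
  covariant : ∀ f : C(X, ℂ), (V : B) * π f * star (V : B) = π (f.comp (φ.symm : C(X, X)))

attribute [instance] CovariantRep.cstar CovariantRep.nontriv

/-- The bounded product of the algebras `B` over all covariant pairs. -/
abbrev BigProduct (φ : X ≃ₜ X) : Type (u + 1) := lp (fun ρ : CovariantRep φ => ρ.B) ∞

/-- The family `(π(f))` indexed by all covariant pairs `(π, V)`. -/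
def bigι (φ : X ≃ₜ X) (f : C(X, ℂ)) : BigProduct φ :=
  ⟨fun ρ => ρ.π f, memℓp_infty ⟨‖f‖, by
    rintro _ ⟨ρ, rfl⟩; exact NonUnitalStarAlgHom.norm_apply_le ρ.π f⟩⟩

/-- The family `(V)` indexed by all covariant pairs `(π, V)`. -/
def bigU (φ : X ≃ₜ X) : BigProduct φ :=
  ⟨fun ρ => (ρ.V : ρ.B), memℓp_infty ⟨1, by
    rintro _ ⟨ρ, rfl⟩; exact (CStarRing.norm_coe_unitary ρ.V).le⟩⟩

/-- The closed `⋆`-subalgebra generated by the copy of `C(X)` and the unitary `(V)`. -/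
def crossedProductSubalgebra (φ : X ≃ₜ X) : StarSubalgebra ℂ (BigProduct φ) :=
  (StarAlgebra.adjoin ℂ (Set.range (bigι φ) ∪ {bigU φ})).topologicalClosure

/-- The crossed product `C(X) ⋊_φ ℤ`: the universal C⋆-algebra generated by a copy of `C(X)` and a
unitary `U` with `U f U⋆ = f ∘ φ⁻¹`. It is realized inside the bounded product over all covariant
pairs; pairs in the universe of `X` are enough, see `CrossedProduct.exists_unique_lift`. -/
def CrossedProduct (φ : X ≃ₜ X) : Type (u + 1) := crossedProductSubalgebra φ

instance crossedProductCStarAlgebra (φ : X ≃ₜ X) : CStarAlgebra (CrossedProduct φ) :=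
  StarSubalgebra.cstarAlgebra (crossedProductSubalgebra φ)
    (h_closed := StarSubalgebra.isClosed_topologicalClosure _)

namespace CrossedProduct

variable (φ : X ≃ₜ X)

variable {φ} in
theorem ext {a b : CrossedProduct φ} (h : ∀ ρ, a.1 ρ = b.1 ρ) : a = b :=
  Subtype.ext (lp.ext (funext h))

/-- The canonical map `C(X) → C(X) ⋊_φ ℤ`. -/
def ι : C(X, ℂ) →⋆ₐ[ℂ] CrossedProduct φ where
  toFun f := ⟨bigι φ f, StarSubalgebra.le_topologicalClosure _
    (StarAlgebra.subset_adjoin _ _ (Or.inl ⟨f, rfl⟩))⟩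
  map_one' := by apply ext; intro ρ; exact map_one ρ.π
  map_mul' f g := by apply ext; intro ρ; exact map_mul ρ.π f g
  map_zero' := by apply ext; intro ρ; exact map_zero ρ.π
  map_add' f g := by apply ext; intro ρ; exact map_add ρ.π f g
  commutes' r := by apply ext; intro ρ; exact AlgHomClass.commutes ρ.π r
  map_star' f := by apply ext; intro ρ; exact map_star ρ.π f

/-- The canonical unitary `U`. -/
def U : unitary (CrossedProduct φ) :=
  ⟨⟨bigU φ, StarSubalgebra.le_topologicalClosure _
    (StarAlgebra.subset_adjoin _ _ (Or.inr rfl))⟩,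
    Unitary.mem_iff.2 ⟨ext fun ρ => Unitary.coe_star_mul_self ρ.V,
      ext fun ρ => Unitary.coe_mul_star_self ρ.V⟩⟩

theorem U_mul_ι_mul_star (f : C(X, ℂ)) :
    (U φ : CrossedProduct φ) * ι φ f * star (U φ : CrossedProduct φ)
      = ι φ (f.comp (φ.symm : C(X, X))) := by
  apply ext; intro ρ; exact ρ.covariant f

variable {φ}

/-- The `⋆`-homomorphism given by a covariant pair. -/
def lift (ρ : CovariantRep φ) : CrossedProduct φ →⋆ₐ[ℂ] ρ.B where
  toFun a := a.1 ρ
  map_one' := rfl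
  map_mul' _ _ := rfl
  map_zero' := rfl
  map_add' _ _ := rfl
  commutes' _ := rfl
  map_star' _ := rfl

theorem lift_ι (ρ : CovariantRep φ) (f : C(X, ℂ)) : lift ρ (ι φ f) = ρ.π f := rfl
theorem lift_U (ρ : CovariantRep φ) : lift ρ (U φ : CrossedProduct φ) = ρ.V := rfl

/-- Induction over the generators `f`, `U`, `U⋆`, for closed properties. -/
theorem closed_induction {p : CrossedProduct φ → Prop} (hclosed : IsClosed {a | p a})
    (hι : ∀ f, p (ι φ f)) (hU : p (U φ)) (hU' : p (star (U φ : CrossedProduct φ)))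
    (add : ∀ a b, p a → p b → p (a + b)) (mul : ∀ a b, p a → p b → p (a * b))
    (a : CrossedProduct φ) : p a := by
  have key : ∀ b ∈ StarAlgebra.adjoin ℂ (Set.range (bigι φ) ∪ {bigU φ}),
      ∃ c : CrossedProduct φ, c.1 = b ∧ p c := by
    intro b hb
    refine Algebra.adjoin_induction
      (p := fun b _ => ∃ c : CrossedProduct φ, c.1 = b ∧ p c) ?_ ?_ ?_ ?_ hb
    · rintro x (( ⟨f, rfl⟩ | rfl) | (⟨f, hf⟩ | hx))
      · exact ⟨_, rfl, hι f⟩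
      · exact ⟨_, rfl, hU⟩
      · refine ⟨_, ?_, hι (star f)⟩
        rw [map_star, ← star_star x, ← hf]; rfl
      · refine ⟨_, ?_, hU'⟩
        rw [← star_star x, Set.mem_singleton_iff.1 hx]; rfl
    · intro r
      refine ⟨_, ?_, hι (algebraMap ℂ _ r)⟩
      rw [AlgHomClass.commutes]; rfl
    · rintro x y hx hy ⟨c, rfl, hc⟩ ⟨d, rfl, hd⟩; exact ⟨_, rfl, add _ _ hc hd⟩
    · rintro x y hx hy ⟨c, rfl, hc⟩ ⟨d, rfl, hd⟩; exact ⟨_, rfl, mul _ _ hc hd⟩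
  have hcl : IsClosed (Subtype.val '' {a : CrossedProduct φ | p a}) :=
    (StarSubalgebra.isClosed_topologicalClosure _).isClosedEmbedding_subtypeVal.isClosedMap _
      hclosed
  have hsub : ((StarAlgebra.adjoin ℂ (Set.range (bigι φ) ∪ {bigU φ}) :
      StarSubalgebra ℂ (BigProduct φ)) : Set (BigProduct φ)) ⊆
      Subtype.val '' {a : CrossedProduct φ | p a} := by
    intro b hb
    obtain ⟨c, rfl, hc⟩ := key b hb
    exact ⟨c, hc, rfl⟩
  obtain ⟨c, hc, hca⟩ := closure_minimal hsub hcl a.2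
  rwa [← Subtype.ext hca]

theorem hom_ext {B : Type*} [CStarAlgebra B] {σ τ : CrossedProduct φ →⋆ₐ[ℂ] B}
    (hι : ∀ f, σ (ι φ f) = τ (ι φ f)) (hU : σ (U φ) = τ (U φ)) : σ = τ := by
  ext a
  have hσ : Continuous σ := (NonUnitalStarAlgHom.instContinuousLinearMapClassComplex).map_continuous σ
  have hτ : Continuous τ := (NonUnitalStarAlgHom.instContinuousLinearMapClassComplex).map_continuous τ
  refine closed_induction (p := fun a => σ a = τ a) (isClosed_eq hσ hτ) hι hU ?_ ?_ ?_ a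
  · simp only [map_star, hU]
  · intro a b ha hb; simp only [map_add, ha, hb]
  · intro a b ha hb; simp only [map_mul, ha, hb]


/-- A C⋆-algebra that is small in the sense of cardinality has a copy in the given universe. -/
theorem exists_small_model (S : Type w) [CStarAlgebra S] [Small.{u} S] :
    ∃ (C : Type u) (_ : CStarAlgebra C), Nonempty (C ≃⋆ₐ[ℂ] S) := by
  let e : Shrink.{u} S ≃ₐ[ℂ] S := Shrink.algEquiv ℂ S
  let i1 : NormedRing (Shrink.{u} S) := NormedRing.induced _ S e e.injective
  have hn : ∀ x : Shrink.{u} S, ‖e x‖ = ‖x‖ := fun x => rfl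
  let i2 : NormedAlgebra ℂ (Shrink.{u} S) := NormedAlgebra.induced ℂ _ S e
  let i3 : StarRing (Shrink.{u} S) :=
    { star := fun x => e.symm (star (e x))
      star_involutive := fun x => by simp
      star_mul := fun x y => by simp
      star_add := fun x y => by simp }
  have hs : ∀ x : Shrink.{u} S, e (star x) = star (e x) := fun x => e.apply_symm_apply _
  have i4 : CStarRing (Shrink.{u} S) := ⟨fun x => by
    rw [← hn (star x * x), map_mul, hs, CStarRing.norm_star_mul_self, hn]⟩
  have i5 : StarModule ℂ (Shrink.{u} S) := ⟨fun r x => e.injective (by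
    rw [hs, map_smul, star_smul, map_smul, hs])⟩
  have i6 : CompleteSpace (Shrink.{u} S) := by
    have hi : Isometry e := AddMonoidHomClass.isometry_of_norm e hn
    exact (IsometryEquiv.mk e.toEquiv hi).completeSpace
  exact ⟨Shrink.{u} S, { }, ⟨{ e with map_star' := hs, map_smul' := map_smul e }⟩⟩

/-- **Universal property**: in whatever universe the unital C⋆-algebra `B` lives, every covariant
pair `(π, V)` in `B` factors through a unique `⋆`-homomorphism of `CrossedProduct φ`. -/
theorem exists_unique_lift {B : Type w} [CStarAlgebra B] (π : C(X, ℂ) →⋆ₐ[ℂ] B) (V : unitary B)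
    (hV : ∀ f : C(X, ℂ), (V : B) * π f * star (V : B) = π (f.comp (φ.symm : C(X, X)))) :
    ∃! σ : CrossedProduct φ →⋆ₐ[ℂ] B, (∀ f, σ (ι φ f) = π f) ∧ σ (U φ) = V := by
  refine existsUnique_of_exists_of_unique ?_ fun σ τ hσ hτ =>
    hom_ext (fun f => (hσ.1 f).trans (hτ.1 f).symm) (hσ.2.trans hτ.2.symm)
  rcases subsingleton_or_nontrivial B with hB | hB
  · exact ⟨{ toFun := fun _ => 0, map_one' := Subsingleton.elim _ _,
             map_mul' := fun _ _ => Subsingleton.elim _ _, map_zero' := rfl,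
             map_add' := fun _ _ => Subsingleton.elim _ _,
             commutes' := fun _ => Subsingleton.elim _ _,
             map_star' := fun _ => Subsingleton.elim _ _ },
      fun _ => Subsingleton.elim _ _, Subsingleton.elim _ _⟩
  let S := (StarAlgebra.adjoin ℂ (Set.range π ∪ {(V : B)})).topologicalClosure
  have hmem : Set.range π ∪ {(V : B)} ⊆ S :=
    (StarAlgebra.subset_adjoin _ _).trans (StarSubalgebra.le_topologicalClosure _)
  let iS : CStarAlgebra S :=
    StarSubalgebra.cstarAlgebra S (h_closed := StarSubalgebra.isClosed_topologicalClosure _)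
  have hsmall : Small.{u} S := by
    let g : C(X, ℂ) ⊕ Bool → B := Sum.elim π fun b => if b then (V : B) else star (V : B)
    have hle : ∀ b ∈ StarAlgebra.adjoin ℂ (Set.range π ∪ {(V : B)}),
        ∃ c, FreeAlgebra.lift ℂ g c = b := by
      intro b hb
      have hg : (Set.range π ∪ {(V : B)}) ∪ star (Set.range π ∪ {(V : B)}) ⊆
          (FreeAlgebra.lift ℂ g).range := by
        rintro x ((⟨f, rfl⟩ | rfl) | (⟨f, hf⟩ | hx))
        · exact ⟨FreeAlgebra.ι ℂ (Sum.inl f), by simp [g]⟩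
        · exact ⟨FreeAlgebra.ι ℂ (Sum.inr true), by simp [g]⟩
        · exact ⟨FreeAlgebra.ι ℂ (Sum.inl (star f)), (FreeAlgebra.lift_ι_apply g _).trans (by
            change π (star f) = x
            rw [map_star, hf, star_star])⟩
        · exact ⟨FreeAlgebra.ι ℂ (Sum.inr false), by
            simp [g, ← Set.mem_singleton_iff.1 hx]⟩
      exact Algebra.adjoin_le hg hb
    have hrange : (S : Set B) ⊆ Set.range fun s : ℕ → FreeAlgebra ℂ (C(X, ℂ) ⊕ Bool) =>
        Filter.limUnder Filter.atTop fun n => FreeAlgebra.lift ℂ g (s n) := by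
      intro b hb
      obtain ⟨s, hs, hsb⟩ := mem_closure_iff_seq_limit.1 hb
      choose c hc using fun n => hle (s n) (hs n)
      exact ⟨c, by simpa only [hc] using hsb.limUnder_eq⟩
    exact small_subset hrange
  obtain ⟨C, iC, ⟨e⟩⟩ := exists_small_model.{u} S
  have hCn : Nontrivial C := e.toEquiv.nontrivial
  let π' : C(X, ℂ) →⋆ₐ[ℂ] S :=
    StarAlgHom.codRestrict π S fun f => hmem (Or.inl ⟨f, rfl⟩)
  let V' : S := ⟨V, hmem (Or.inr rfl)⟩
  have hV' : V' ∈ unitary S := Unitary.mem_iff.2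
    ⟨Subtype.ext (Unitary.coe_star_mul_self V), Subtype.ext (Unitary.coe_mul_star_self V)⟩
  let ρ : CovariantRep φ :=
    { B := C
      π := (e.symm : S →⋆ₐ[ℂ] C).comp π'
      V := ⟨e.symm V', Unitary.map_mem e.symm hV'⟩
      covariant := fun f => by
        have h : V' * π' f * star V' = π' (f.comp (φ.symm : C(X, X))) := Subtype.ext (hV f)
        change e.symm V' * e.symm (π' f) * star (e.symm V') =
          e.symm (π' (f.comp (φ.symm : C(X, X))))
        rw [← h, map_mul, map_mul, map_star] }
  refine ⟨(S.subtype.comp (e : C →⋆ₐ[ℂ] S)).comp (lift ρ), fun f => ?_, ?_⟩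
  · change ((e (e.symm (π' f)) : S) : B) = π f
    rw [e.apply_symm_apply]; rfl
  · change ((e (e.symm V') : S) : B) = V
    rw [e.apply_symm_apply]

/-! ### The flow -/

/-- The unitary function `e^{-itF}`. -/
def phase (F : C(X, ℝ)) (t : ℝ) : unitary C(X, ℂ) :=
  ⟨⟨fun x => Complex.exp (-(Complex.I * t * F x)), by fun_prop⟩, by
    have h : ∀ x, (starRingEnd ℂ) (Complex.exp (-(Complex.I * t * F x))) *
        Complex.exp (-(Complex.I * t * F x)) = 1 := fun x => by
      rw [← Complex.exp_conj, ← Complex.exp_add]; simp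
    refine Unitary.mem_iff.2 ⟨?_, ?_⟩ <;> ext x
    · exact h x
    · exact (mul_comm _ _).trans (h x)⟩

/-- The covariant pair `(π, V π(w))`, for a unitary `w ∈ C(X)`. -/
def twistRep (ρ : CovariantRep φ) (w : unitary C(X, ℂ)) : CovariantRep φ where
  B := ρ.B
  π := ρ.π
  V := ρ.V * ⟨ρ.π w, Unitary.map_mem ρ.π w.2⟩
  covariant f := by
    have h : ρ.π w * ρ.π f * star (ρ.π (w : C(X, ℂ))) = ρ.π f := by
      rw [← map_star, ← map_mul, ← map_mul, mul_comm (w : C(X, ℂ)) f, mul_assoc,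
        Unitary.mul_star_self_of_mem w.2, mul_one]
    calc _ = (ρ.V : ρ.B) * (ρ.π w * ρ.π f * star (ρ.π (w : C(X, ℂ)))) * star (ρ.V : ρ.B) := by
          simp [mul_assoc]
      _ = _ := by rw [h, ρ.covariant f]

/-- Composition with `(π, V) ↦ (π, V π(w))` on the bounded product. -/
def bigTwist (φ : X ≃ₜ X) (w : unitary C(X, ℂ)) : BigProduct φ →⋆ₐ[ℂ] BigProduct φ where
  toFun a := ⟨fun ρ => a (twistRep ρ w), memℓp_infty ⟨‖a‖, by
    rintro _ ⟨ρ, rfl⟩; exact lp.norm_apply_le_norm ENNReal.top_ne_zero a _⟩⟩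
  map_one' := rfl
  map_mul' _ _ := rfl
  map_zero' := rfl
  map_add' _ _ := rfl
  commutes' _ := rfl
  map_star' _ := rfl

theorem bigTwist_mem (w : unitary C(X, ℂ)) (a : CrossedProduct φ) :
    bigTwist φ w a.1 ∈ crossedProductSubalgebra φ := by
  have hc : Continuous (bigTwist φ w) :=
    (NonUnitalStarAlgHom.instContinuousLinearMapClassComplex).map_continuous (bigTwist φ w)
  refine closed_induction (p := fun a => bigTwist φ w a.1 ∈ crossedProductSubalgebra φ)
    ?_ ?_ ?_ ?_ ?_ ?_ a
  · exact (StarSubalgebra.isClosed_topologicalClosure _).preimage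
      (hc.comp continuous_subtype_val)
  · exact fun f => (ι φ f).2
  · exact ((U φ : CrossedProduct φ) * ι φ w).2
  · exact (star ((U φ : CrossedProduct φ) * ι φ w)).2
  · intro a b ha hb
    exact add_mem ha hb
  · intro a b ha hb
    exact mul_mem ha hb

/-- The endomorphism determined by `f ↦ f` and `U ↦ U w`, for a unitary `w ∈ C(X)`. -/
def twist (φ : X ≃ₜ X) (w : unitary C(X, ℂ)) : CrossedProduct φ →⋆ₐ[ℂ] CrossedProduct φ where
  toFun a := ⟨bigTwist φ w a.1, bigTwist_mem w a⟩
  map_one' := rfl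
  map_mul' _ _ := rfl
  map_zero' := rfl
  map_add' _ _ := rfl
  commutes' _ := rfl
  map_star' _ := rfl

theorem twist_ι (w : unitary C(X, ℂ)) (f : C(X, ℂ)) : twist φ w (ι φ f) = ι φ f := rfl

theorem twist_U (w : unitary C(X, ℂ)) :
    twist φ w (U φ : CrossedProduct φ) = (U φ : CrossedProduct φ) * ι φ w := rfl

theorem twist_twist (v w : unitary C(X, ℂ)) :
    (twist φ v).comp (twist φ w) = twist φ (v * w) := by
  refine hom_ext (fun f => rfl) ?_
  simp [twist_U, twist_ι, mul_assoc]

theorem twist_one : twist φ 1 = StarAlgHom.id ℂ (CrossedProduct φ) := by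
  refine hom_ext (fun f => rfl) ?_
  simp [twist_U]

/-- The flow `α^F` on `C(X) ⋊_φ ℤ`, determined by `α^F_t(f U) = f U e^{-itF}`. -/
def flow (φ : X ≃ₜ X) (F : C(X, ℝ)) (t : ℝ) : CrossedProduct φ ≃⋆ₐ[ℂ] CrossedProduct φ :=
  StarAlgEquiv.ofStarAlgHom (twist φ (phase F t)) (twist φ (star (phase F t)))
    (by rw [twist_twist, Unitary.star_mul_self, twist_one])
    (by rw [twist_twist, Unitary.mul_star_self, twist_one])

theorem flow_ι_mul_U (F : C(X, ℝ)) (t : ℝ) (f : C(X, ℂ)) :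
    flow φ F t (ι φ f * (U φ : CrossedProduct φ)) =
      ι φ f * (U φ : CrossedProduct φ) * ι φ (phase F t : C(X, ℂ)) := by
  rw [mul_assoc]; rfl

theorem flow_ι (F : C(X, ℝ)) (t : ℝ) (f : C(X, ℂ)) : flow φ F t (ι φ f) = ι φ f := rfl

/-! ### The conditional expectation

For `x ∈ X` let `C(X) ⋊_φ ℤ` act on `ℓ²(ℤ)` by `(f ξ)(n) = f(φⁿ x) ξ(n)` and
`(U ξ)(n) = ξ(n - 1)`. Then `E(a)(x)` is the `(0, 0)` matrix coefficient of `a`.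
-/

/-- The Hilbert space `ℓ²(ℤ)`, in the universe `u`. -/
abbrev ellTwo : Type u := lp (fun _ : ULift.{u} ℤ => ℂ) 2

/-- Multiplication by a bounded sequence. -/
def diagOp (d : ULift.{u} ℤ → ℂ) (K : ℝ) (hK : 0 ≤ K) (hd : ∀ n, ‖d n‖ ≤ K) :
    ellTwo.{u} →L[ℂ] ellTwo.{u} :=
  lp.mapCLM 2 (fun n => d n • ContinuousLinearMap.id ℂ ℂ) hK (fun n => by
    simpa [norm_smul] using hd n)

theorem diagOp_apply (d : ULift.{u} ℤ → ℂ) (K : ℝ) (hK : 0 ≤ K) (hd : ∀ n, ‖d n‖ ≤ K)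
    (ξ : ellTwo.{u}) (n : ULift.{u} ℤ) : diagOp d K hK hd ξ n = d n * ξ n := rfl

/-- Translation by `k`. -/
def translate (k : ℤ) : ellTwo.{u} →ₗᵢ[ℂ] ellTwo.{u} where
  toFun ξ := ⟨fun n => ξ ⟨n.down - k⟩, by
    have h := (lp.memℓp ξ).summable (by norm_num)
    refine memℓp_gen ?_
    exact h.comp_injective (i := fun n : ULift.{u} ℤ => (⟨n.down - k⟩ : ULift.{u} ℤ))
      (fun a b hab => ULift.ext _ _ (sub_left_injective (congrArg ULift.down hab)))⟩
  map_add' _ _ := rfl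
  map_smul' _ _ := rfl
  norm_map' ξ := by
    rw [lp.norm_eq_tsum_rpow (by norm_num), lp.norm_eq_tsum_rpow (by norm_num)]
    congr 1
    exact ((Equiv.ulift.trans (Equiv.subRight k)).trans Equiv.ulift.symm).tsum_eq
      (fun n : ULift.{u} ℤ => ‖ξ n‖ ^ (2 : ℝ≥0∞).toReal)

theorem translate_apply (k : ℤ) (ξ : ellTwo.{u}) (n : ULift.{u} ℤ) :
    translate k ξ n = ξ ⟨n.down - k⟩ := rfl

/-- The bilateral shift. -/
def shiftEquiv : ellTwo.{u} ≃ₗᵢ[ℂ] ellTwo.{u} :=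
  { translate 1 with
    invFun := translate (-1)
    left_inv := fun ξ => lp.ext (funext fun n => by simp [translate_apply])
    right_inv := fun ξ => lp.ext (funext fun n => by simp [translate_apply]) }

theorem shiftEquiv_apply (ξ : ellTwo.{u}) (n : ULift.{u} ℤ) :
    shiftEquiv ξ n = ξ ⟨n.down - 1⟩ := rfl

/-- `C(X)` acting on `ℓ²(ℤ)` along the orbit of `x`. -/
def orbitRep (φ : X ≃ₜ X) (x : X) : C(X, ℂ) →⋆ₐ[ℂ] (ellTwo.{u} →L[ℂ] ellTwo.{u}) where
  toFun f := diagOp (fun n => f ((φ ^ n.down) x)) ‖f‖ (norm_nonneg f)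
    (fun n => f.norm_coe_le_norm _)
  map_one' := by ext ξ n; simp [diagOp_apply]
  map_mul' f g := by ext ξ n; simp [diagOp_apply, mul_assoc]
  map_zero' := by ext ξ n; simp [diagOp_apply]
  map_add' f g := by ext ξ n; simp [diagOp_apply, add_mul]
  commutes' r := by ext ξ n; simp [diagOp_apply, Algebra.algebraMap_eq_smul_one]
  map_star' f := by
    rw [ContinuousLinearMap.star_eq_adjoint, ContinuousLinearMap.eq_adjoint_iff]
    intro ξ η
    rw [lp.inner_eq_tsum, lp.inner_eq_tsum]
    refine tsum_congr fun n => ?_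
    simp [diagOp_apply]
    ring


/-- The standard basis vector `δ_n`. -/
def basisVec (n : ℤ) : ellTwo.{u} := lp.single 2 (⟨n⟩ : ULift.{u} ℤ) (1 : ℂ)

theorem basisVec_apply (n : ℤ) (m : ULift.{u} ℤ) :
    basisVec.{u} n m = if m.down = n then 1 else 0 := by
  by_cases h : m = ⟨n⟩
  · subst h; simp [basisVec]
  · have h' : m.down ≠ n := fun e => h (ULift.ext _ _ e)
    rw [if_neg h']
    exact lp.single_apply_ne 2 _ _ h

instance : Nontrivial ellTwo.{u} :=
  ⟨⟨basisVec 0, 0, fun h => by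
    have := congrArg (fun ξ : ellTwo.{u} => ξ ⟨0⟩) h
    simp [basisVec_apply] at this⟩⟩

theorem orbitRep_apply (φ : X ≃ₜ X) (x : X) (f : C(X, ℂ)) (ξ : ellTwo.{u}) (n : ULift.{u} ℤ) :
    orbitRep φ x f ξ n = f ((φ ^ n.down) x) * ξ n := rfl

/-- The covariant pair on `ℓ²(ℤ)` given by the orbit of `x`. -/
def regularRep (φ : X ≃ₜ X) (x : X) : CovariantRep φ where
  B := ellTwo.{u} →L[ℂ] ellTwo.{u}
  nontriv := inferInstance
  π := orbitRep φ x
  V := Unitary.linearIsometryEquiv.symm shiftEquiv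
  covariant f := by
    have h : ((Unitary.linearIsometryEquiv.symm shiftEquiv :
        unitary (ellTwo.{u} →L[ℂ] ellTwo.{u})) : ellTwo.{u} →L[ℂ] ellTwo.{u}) * orbitRep φ x f =
        orbitRep φ x (f.comp (φ.symm : C(X, X))) *
          (Unitary.linearIsometryEquiv.symm shiftEquiv :
            unitary (ellTwo.{u} →L[ℂ] ellTwo.{u})) := by
      refine ContinuousLinearMap.ext fun ξ => lp.ext (funext fun n => ?_)
      change f ((φ ^ (n.down - 1)) x) * ξ ⟨n.down - 1⟩ =
        f (φ.symm ((φ ^ n.down) x)) * ξ ⟨n.down - 1⟩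
      congr 2
      rw [sub_eq_neg_add, zpow_add, zpow_neg_one]
      rfl
    rw [h, mul_assoc, Unitary.mul_star_self_of_mem (Subtype.prop _), mul_one]

/-- The representation of `C(X) ⋊_φ ℤ` on `ℓ²(ℤ)` given by the orbit of `x`. -/
def reg (φ : X ≃ₜ X) (x : X) : CrossedProduct φ →⋆ₐ[ℂ] (ellTwo.{u} →L[ℂ] ellTwo.{u}) :=
  lift (regularRep φ x)

theorem reg_ι_apply (x : X) (f : C(X, ℂ)) (ξ : ellTwo.{u}) (n : ULift.{u} ℤ) :
    reg φ x (ι φ f) ξ n = f ((φ ^ n.down) x) * ξ n := rfl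

theorem reg_U_apply (x : X) (ξ : ellTwo.{u}) (n : ULift.{u} ℤ) :
    reg φ x (U φ : CrossedProduct φ) ξ n = ξ ⟨n.down - 1⟩ := rfl

theorem norm_reg_apply_le (x : X) (a : CrossedProduct φ) (ξ : ellTwo.{u}) :
    ‖reg φ x a ξ‖ ≤ ‖a‖ * ‖ξ‖ :=
  (reg φ x a).le_of_opNorm_le (NonUnitalStarAlgHom.norm_apply_le (reg φ x) a) ξ

theorem reg_ι_basisVec (x : X) (f : C(X, ℂ)) (n : ℤ) :
    reg φ x (ι φ f) (basisVec n) = f ((φ ^ n) x) • basisVec.{u} n := by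
  refine lp.ext (funext fun m => ?_)
  change f ((φ ^ m.down) x) * basisVec.{u} n m = f ((φ ^ n) x) * basisVec.{u} n m
  rw [basisVec_apply]
  split_ifs with h
  · rw [h]
  · simp

theorem reg_U_basisVec (x : X) (n : ℤ) :
    reg φ x (U φ : CrossedProduct φ) (basisVec n) = basisVec.{u} (n + 1) := by
  refine lp.ext (funext fun m => ?_)
  rw [reg_U_apply]
  simp only [basisVec_apply, sub_eq_iff_eq_add]

theorem continuous_of_approx {Z Y : Type*} [TopologicalSpace Z] [NormedAddCommGroup Y]
    {g : Z → Y} (h : ∀ ε > 0, ∃ g' : Z → Y, Continuous g' ∧ ∀ x, ‖g x - g' x‖ < ε) :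
    Continuous g := by
  refine continuous_of_uniform_approx_of_continuous fun u hu => ?_
  obtain ⟨ε, hε, hεu⟩ := Metric.mem_uniformity_dist.1 hu
  obtain ⟨g', hg', hgg'⟩ := h ε hε
  exact ⟨g', hg', fun y => hεu (by rw [dist_eq_norm]; exact hgg' y)⟩

theorem continuous_reg_ι_apply (f : C(X, ℂ)) (ξ : ellTwo.{u}) :
    Continuous fun x => reg φ x (ι φ f) ξ := by
  refine continuous_of_approx fun ε hε => ?_
  have hC : 0 < ‖ι φ f‖ + 1 := by positivity
  obtain ⟨s, hs⟩ := ((Metric.tendsto_nhds.1 (lp.hasSum_single ENNReal.ofNat_ne_top ξ))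
    (ε / (‖ι φ f‖ + 1)) (by positivity)).exists
  refine ⟨fun x => reg φ x (ι φ f) (∑ i ∈ s, lp.single 2 i (ξ i)), ?_, fun x => ?_⟩
  · simp only [map_sum]
    refine continuous_finsetSum _ fun i _ => ?_
    have h : ∀ x, reg φ x (ι φ f) (lp.single 2 i (ξ i)) =
        f ((φ ^ i.down) x) • (lp.single 2 i (ξ i) : ellTwo.{u}) := by
      intro x
      refine lp.ext (funext fun m => ?_)
      change f ((φ ^ m.down) x) * (lp.single 2 i (ξ i) : ellTwo.{u}) m =
        f ((φ ^ i.down) x) * (lp.single 2 i (ξ i) : ellTwo.{u}) m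
      by_cases hm : m = i
      · rw [hm]
      · rw [lp.single_apply_ne 2 _ _ hm, mul_zero, mul_zero]
    simp only [h]
    exact (f.continuous.comp (φ ^ i.down).continuous).smul continuous_const
  · rw [← map_sub]
    rw [dist_comm, dist_eq_norm] at hs
    calc _ ≤ ‖ι φ f‖ * ‖ξ - ∑ i ∈ s, lp.single 2 i (ξ i)‖ := norm_reg_apply_le _ _ _
      _ ≤ (‖ι φ f‖ + 1) * ‖ξ - ∑ i ∈ s, lp.single 2 i (ξ i)‖ := by gcongr; linarith
      _ < (‖ι φ f‖ + 1) * (ε / (‖ι φ f‖ + 1)) := by gcongr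
      _ = ε := by field_simp

theorem continuous_reg_apply (a : CrossedProduct φ) (ξ : ellTwo.{u}) :
    Continuous fun x => reg φ x a ξ := by
  refine closed_induction (p := fun a => ∀ ξ : ellTwo.{u}, Continuous fun x => reg φ x a ξ)
    ?_ continuous_reg_ι_apply ?_ ?_ ?_ ?_ a ξ
  · refine isClosed_of_closure_subset fun a ha ξ => continuous_of_approx fun ε hε => ?_
    obtain ⟨b, hb, hab⟩ := Metric.mem_closure_iff.1 ha (ε / (‖ξ‖ + 1)) (by positivity)
    refine ⟨_, hb ξ, fun x => ?_⟩
    rw [← sub_apply, ← map_sub]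
    rw [dist_eq_norm] at hab
    calc _ ≤ ‖a - b‖ * ‖ξ‖ := norm_reg_apply_le _ _ _
      _ ≤ ‖a - b‖ * (‖ξ‖ + 1) := by gcongr; linarith
      _ < ε / (‖ξ‖ + 1) * (‖ξ‖ + 1) := by gcongr
      _ = ε := by field_simp
  · intro ξ
    exact continuous_const
  · intro ξ
    have : ∀ x y : X, reg φ x (star (U φ : CrossedProduct φ)) ξ =
        reg φ y (star (U φ : CrossedProduct φ)) ξ := fun x y => rfl
    exact continuous_of_const this
  · intro a b ha hb ξ
    simp only [map_add, add_apply]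
    exact (ha ξ).add (hb ξ)
  · intro a b ha hb ξ
    simp only [map_mul, mul_apply_eq_comp]
    rw [continuous_iff_continuousAt]
    intro x₀
    have h1 : Filter.Tendsto (fun x => reg φ x a (reg φ x₀ b ξ)) (nhds x₀)
        (nhds (reg φ x₀ a (reg φ x₀ b ξ))) := (ha _).continuousAt
    have h2 : Filter.Tendsto (fun x => ‖a‖ * ‖reg φ x b ξ - reg φ x₀ b ξ‖) (nhds x₀)
        (nhds 0) := by
      have h3 : Filter.Tendsto (fun x => reg φ x b ξ - reg φ x₀ b ξ) (nhds x₀) (nhds 0) := by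
        have h4 : Filter.Tendsto (fun x => reg φ x b ξ) (nhds x₀) (nhds (reg φ x₀ b ξ)) :=
          (hb ξ).continuousAt
        simpa using h4.sub_const (reg φ x₀ b ξ)
      simpa using h3.norm.const_mul ‖a‖
    have h5 : Filter.Tendsto (fun x => reg φ x a (reg φ x b ξ - reg φ x₀ b ξ)) (nhds x₀)
        (nhds 0) := squeeze_zero_norm (fun x => norm_reg_apply_le _ _ _) h2
    have h6 := h5.add h1
    simpa [ContinuousAt, map_sub] using h6

/-- The canonical conditional expectation `E : C(X) ⋊_φ ℤ → C(X)`, with `E(f) = f` and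
`E(f Uⁿ) = 0` for `n ≠ 0`. -/
def E (φ : X ≃ₜ X) : CrossedProduct φ →ₗ[ℂ] C(X, ℂ) where
  toFun a := ⟨fun x => reg φ x a (basisVec 0) (⟨0⟩ : ULift.{u} ℤ),
    (lp.evalCLM ℂ (fun _ : ULift.{u} ℤ => ℂ) 2 ⟨0⟩).continuous.comp
      (continuous_reg_apply a (basisVec 0))⟩
  map_add' _ _ := rfl
  map_smul' _ _ := rfl

theorem E_ι_mul_U_zpow (f : C(X, ℂ)) (n : ℤ) :
    E φ (ι φ f * ((U φ ^ n : unitary (CrossedProduct φ)) : CrossedProduct φ)) =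
      if n = 0 then f else 0 := by
  have hU : ∀ (x : X) (n k : ℤ), reg φ x
      ((U φ ^ n : unitary (CrossedProduct φ)) : CrossedProduct φ) (basisVec k) =
        basisVec.{u} (k + n) := by
    intro x n
    have hmul : ∀ (p q : unitary (CrossedProduct φ)) (ξ : ellTwo.{u}),
        reg φ x ((p * q : unitary (CrossedProduct φ)) : CrossedProduct φ) ξ =
          reg φ x (p : CrossedProduct φ) (reg φ x (q : CrossedProduct φ) ξ) := by
      intro p q ξ
      rw [Submonoid.coe_mul, map_mul]; rfl
    induction n with
    | zero => intro k; simp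
    | succ j ih =>
      intro k
      rw [zpow_add_one, hmul, reg_U_basisVec, ih]
      congr 1; ring
    | pred j ih =>
      intro k
      have h := hmul (U φ ^ (-(j : ℤ) - 1)) (U φ) (basisVec (k - 1))
      rw [← zpow_add_one, sub_add_cancel, ih, reg_U_basisVec, sub_add_cancel] at h
      rw [← h]
      congr 1; ring
  ext x
  change reg φ x (ι φ f * ((U φ ^ n : unitary (CrossedProduct φ)) : CrossedProduct φ))
    (basisVec 0) ⟨0⟩ = _
  rw [map_mul, mul_apply_eq_comp, hU, reg_ι_apply, basisVec_apply]
  by_cases hn : n = 0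
  · subst hn; simp
  · simp [hn, Ne.symm hn]

end CrossedProduct

end CrossedProduct

section KMS

variable {A : Type*} [CStarAlgebra A]

/-- A state: a positive linear functional with `ω(1) = 1`. Elements of `WeakDual ℂ A` are the
continuous functionals, with the weak-⋆ topology. -/
def IsState (ω : WeakDual ℂ A) : Prop :=
  (∀ a : A, 0 ≤ ω (star a * a)) ∧ ω 1 = 1

/-- `g` is the entire extension `z ↦ α_z(a)` of the orbit `t ↦ α_t(a)`; an element with such an
extension is analytic for `α`. -/
def IsEntireExtension (α : ℝ → A ≃⋆ₐ[ℂ] A) (a : A) (g : ℂ → A) : Prop :=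
  Differentiable ℂ g ∧ ∀ t : ℝ, g (t : ℂ) = α t a

/-- A state `ω` is a `β`-KMS state for `α` when `ω(a b) = ω(b α_{iβ}(a))` for all `a`, `b` in a
dense `α`-invariant `⋆`-subalgebra of `α`-analytic elements. -/
def IsKMSState (α : ℝ → A ≃⋆ₐ[ℂ] A) (β : ℝ) (ω : WeakDual ℂ A) : Prop :=
  IsState ω ∧ ∃ D : NonUnitalStarSubalgebra ℂ A,
    Dense (D : Set A) ∧ (∀ t : ℝ, ∀ a ∈ D, α t a ∈ D) ∧
    ∀ a ∈ D, ∃ g : ℂ → A, IsEntireExtension α a g ∧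
      ∀ b ∈ D, ω (a * b) = ω (b * g (Complex.I * β))

/-- The set of `β`-KMS states for `α`. -/
def kmsStates (α : ℝ → A ≃⋆ₐ[ℂ] A) (β : ℝ) : Set (WeakDual ℂ A) :=
  {ω | IsKMSState α β ω}

end KMS

section Dynamics

variable {X : Type*} [TopologicalSpace X]

/-- A homeomorphism is minimal when all its orbits `{φⁿ(x) : n ∈ ℤ}` are dense. -/
def IsMinimalHomeo (φ : X ≃ₜ X) : Prop :=
  ∀ x : X, Dense (Set.range fun n : ℤ => (φ ^ n) x)

variable [MeasurableSpace X]

/-- The `e^{βF}`-conformal measures: the Borel probability measures `m` with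
`m(φ(B)) = ∫_B e^{βF} dm` for all Borel sets `B`. -/
def conformalMeasures (φ : X ≃ₜ X) (F : C(X, ℝ)) (β : ℝ) : Set (ProbabilityMeasure X) :=
  {m | ∀ B : Set X, MeasurableSet B →
    (m : Measure X) (φ '' B) = ∫⁻ x in B, ENNReal.ofReal (Real.exp (β * F x)) ∂(m : Measure X)}

end Dynamics

end KMSCrossed

end

open KMSCrossed

/-! A function `f` in `C(X)` is fixed by the flow, so a KMS state `ω` satisfies `ω(f b) = ω(b f)`
for every `b`. With `b = h Uⁿ` this gives `ω(h (g ∘ φ⁻ⁿ - g) Uⁿ) = 0`. Minimality on an infinite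
space leaves no periodic points, so for `n ≠ 0` the functions `g ∘ φ⁻ⁿ - g` lie in no maximal ideal
of `C(X)`. Hence `ω` kills `C(X) Uⁿ` (`kmsState_ι_mul_U_zpow`), and `ω` is its restriction to `C(X)`
composed with `E` (`kmsState_eq_stateOfMeasure`). By Riesz the restriction is integration against
some `m`. Since `U` continues to `U e^{βF}` at time `iβ`, the KMS condition for `U` and `f U⋆` reads
`∫ f ∘ φ⁻¹ dm = ∫ e^{βF} f dm`, which is conformality (`exists_conformalMeasure`).

Conversely, for conformal `m` the functional `∫ E(·) dm` satisfies the KMS identity on `C(X)` and on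
`U`, and the identity passes to sums, products and adjoints (`isKMSState_stateOfMeasure`). Both
topologies are topologies of pointwise convergence, and `E(a)` is continuous, so the bijection is
bicontinuous.

The analytic difficulty is that the dense algebra in the definition may depend on `ω` and need not
contain `C(X)` or `U`. A three-lines argument (`IsKMSState.apply_mul`) extends the condition to all
analytic elements; it also yields convexity, where two states may come with different algebras. -/

noncomputable section

namespace KMSCrossed

open Filter Topology

/-! ### Three-lines estimates on a strip -/

section Strip

/-- A bounded entire function on the closed strip `0 ≤ Re z ≤ 1` is bounded by its bound on the
two edges. -/
theorem norm_le_of_strip_edges {h : ℂ → ℂ} (hd : Differentiable ℂ h) {K C : ℝ}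
    (hK : ∀ z : ℂ, z.re ∈ Set.Icc (0 : ℝ) 1 → ‖h z‖ ≤ K) (hC : 0 < C)
    (h0 : ∀ z : ℂ, z.re = 0 → ‖h z‖ ≤ C) (h1 : ∀ z : ℂ, z.re = 1 → ‖h z‖ ≤ C)
    {s : ℝ} (hs : s ∈ Set.Icc (0 : ℝ) 1) : ‖h s‖ ≤ C := by
  have key := Complex.HadamardThreeLines.norm_le_interp_of_mem_verticalClosedStrip'
    (f := h) (z := (s : ℂ)) (a := C) (b := C) zero_lt_one
    (by simpa [Complex.HadamardThreeLines.verticalClosedStrip] using hs) hd.diffContOnCl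
    ⟨K, by rintro _ ⟨z, hz, rfl⟩; exact hK z hz⟩ h0 h1
  simpa [← Real.rpow_add hC] using key

/-- If entire functions `G n`, bounded on the strip `0 ≤ Re z ≤ 1`, converge uniformly on both of
its edges, and to `H` on the left edge, then `G n 1` converges to `H 1`. -/
theorem tendsto_at_one_of_strip_edges {H : ℂ → ℂ} {G : ℕ → ℂ → ℂ} (hH : Differentiable ℂ H)
    (hG : ∀ n, Differentiable ℂ (G n)) {KH : ℝ}
    (hKH : ∀ z : ℂ, z.re ∈ Set.Icc (0 : ℝ) 1 → ‖H z‖ ≤ KH)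
    (hKG : ∀ n, ∃ K : ℝ, ∀ z : ℂ, z.re ∈ Set.Icc (0 : ℝ) 1 → ‖G n z‖ ≤ K)
    {ε : ℕ → ℝ} (hε : Tendsto ε atTop (𝓝 0)) (hpos : ∀ n, 0 < ε n) (hanti : Antitone ε)
    (h0 : ∀ n (z : ℂ), z.re = 0 → ‖H z - G n z‖ ≤ ε n)
    (h1 : ∀ n m (z : ℂ), z.re = 1 → ‖G n z - G m z‖ ≤ ε n + ε m) :
    Tendsto (fun n => G n 1) atTop (𝓝 (H 1)) := by
  have hcauchy : ∀ n m (s : ℝ), s ∈ Set.Icc (0 : ℝ) 1 → ‖G n s - G m s‖ ≤ ε n + ε m := by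
    intro n m s hs
    obtain ⟨Kn, hn⟩ := hKG n
    obtain ⟨Km, hm⟩ := hKG m
    refine norm_le_of_strip_edges (h := fun z => G n z - G m z) ((hG n).sub (hG m))
      (K := Kn + Km) (fun z hz => (norm_sub_le _ _).trans (add_le_add (hn z hz) (hm z hz)))
      (add_pos (hpos n) (hpos m)) (fun z hz => ?_) (h1 n m) hs
    calc ‖G n z - G m z‖ = ‖(H z - G m z) - (H z - G n z)‖ := by congr 1; ring
      _ ≤ ‖H z - G m z‖ + ‖H z - G n z‖ := norm_sub_le _ _
      _ ≤ ε n + ε m := by linarith [h0 n z hz, h0 m z hz]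
  obtain ⟨K0, hK0⟩ := hKG 0
  -- `M` bounds `H - G n` on the right edge uniformly in `n`: compare `G n` with `G 0` there and use
  -- `ε n ≤ ε 0`. No smallness on that edge is known for `H`, so the three-lines bound tends to zero
  -- only for `s < 1`.
  set M : ℝ := KH + K0 + (ε 0 + ε 0) with hM
  have hinner : ∀ s : ℝ, s ∈ Set.Ioo (0 : ℝ) 1 →
      Tendsto (fun n => G n s) atTop (𝓝 (H s)) := by
    intro s hs
    have hb : ∀ n, ‖H s - G n s‖ ≤ ε n ^ (1 - s) * M ^ s := by
      intro n
      obtain ⟨Kn, hn⟩ := hKG n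
      have key := Complex.HadamardThreeLines.norm_le_interp_of_mem_verticalClosedStrip'
        (f := fun z => H z - G n z) (z := (s : ℂ)) (a := ε n) (b := M) zero_lt_one
        (by simpa [Complex.HadamardThreeLines.verticalClosedStrip] using
          Set.Ioo_subset_Icc_self hs)
        (hH.sub (hG n)).diffContOnCl
        ⟨KH + Kn, by
          rintro _ ⟨z, hz, rfl⟩
          exact (norm_sub_le _ _).trans (add_le_add (hKH z hz) (hn z hz))⟩ (h0 n) (fun z hz => by
            have hz' : z.re ∈ Set.Icc (0 : ℝ) 1 := by
              rw [show z.re = 1 from hz]; simp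
            calc ‖H z - G n z‖ = ‖H z - G 0 z - (G n z - G 0 z)‖ := by congr 1; ring
              _ ≤ ‖H z‖ + ‖G 0 z‖ + ‖G n z - G 0 z‖ :=
                (norm_sub_le _ _).trans (add_le_add_left (norm_sub_le _ _) _)
              _ ≤ M := by
                linarith [hKH z hz', hK0 z hz', h1 n 0 z hz, hanti (Nat.zero_le n)])
      simpa using key
    have hlim : Tendsto (fun n => ε n ^ (1 - s) * M ^ s) atTop (𝓝 0) := by
      have := (hε.rpow_const (p := 1 - s) (Or.inr (by linarith [hs.2]))).mul_const (M ^ s)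
      rwa [Real.zero_rpow (by linarith [hs.2]), zero_mul] at this
    rw [tendsto_iff_norm_sub_tendsto_zero]
    refine squeeze_zero (fun _ => norm_nonneg _) (fun n => ?_) hlim
    rw [norm_sub_rev]; exact hb n
  -- Letting `n → ∞` in `hcauchy` replaces the interpolated bound by one independent of `s`, which
  -- survives the limit `s → 1`.
  have hinner' : ∀ m (s : ℝ), s ∈ Set.Ioo (0 : ℝ) 1 → ‖H s - G m s‖ ≤ ε m := by
    intro m s hs
    have h2 : Tendsto (fun n => ‖G n s - G m s‖) atTop (𝓝 ‖H s - G m s‖) :=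
      ((hinner s hs).sub_const _).norm
    have h3 : Tendsto (fun n => ε n + ε m) atTop (𝓝 (0 + ε m)) := hε.add_const _
    rw [zero_add] at h3
    exact le_of_tendsto_of_tendsto' h2 h3 fun n => hcauchy n m s (Set.Ioo_subset_Icc_self hs)
  have hedge : ∀ m, ‖H 1 - G m 1‖ ≤ ε m := by
    intro m
    have hc : Continuous fun s : ℝ => ‖H s - G m s‖ :=
      ((hH.continuous.comp Complex.continuous_ofReal).sub
        ((hG m).continuous.comp Complex.continuous_ofReal)).norm
    have hcl : (1 : ℝ) ∈ closure (Set.Ioo (0 : ℝ) 1) := by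
      rw [closure_Ioo zero_ne_one]; simp
    have := closure_minimal (t := {s : ℝ | ‖H s - G m s‖ ≤ ε m}) (fun s hs => hinner' m s hs)
      (isClosed_le hc continuous_const) hcl
    simpa using this
  rw [tendsto_iff_norm_sub_tendsto_zero]
  refine squeeze_zero (fun _ => norm_nonneg _) (fun n => ?_) hε
  rw [norm_sub_rev]; exact hedge n

end Strip

/-! ### KMS states of a general flow -/

section AbstractKMS

variable {A : Type*} [CStarAlgebra A] {α : ℝ → A ≃⋆ₐ[ℂ] A}

theorem continuous_starAlgEquiv (e : A ≃⋆ₐ[ℂ] A) : Continuous e :=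
  (NonUnitalStarAlgHom.instContinuousLinearMapClassComplex).map_continuous (e : A →⋆ₐ[ℂ] A)

theorem norm_starAlgEquiv (e : A ≃⋆ₐ[ℂ] A) (a : A) : ‖e a‖ = ‖a‖ :=
  NonUnitalStarAlgHom.norm_map (e : A →⋆ₐ[ℂ] A) e.injective a

theorem differentiable_starAlgEquiv_comp (e : A ≃⋆ₐ[ℂ] A) {g : ℂ → A} (hg : Differentiable ℂ g) :
    Differentiable ℂ fun z => e (g z) :=
  (ContinuousLinearMap.differentiable
    (⟨(e : A →⋆ₐ[ℂ] A).toAlgHom.toLinearMap, continuous_starAlgEquiv e⟩ : A →L[ℂ] A)).comp hg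

/-- Entire functions that agree on the real axis are equal. -/
theorem eq_of_eq_on_reals {g h : ℂ → A} (hg : Differentiable ℂ g) (hh : Differentiable ℂ h)
    (heq : ∀ t : ℝ, g t = h t) : g = h := by
  refine AnalyticOnNhd.eq_of_frequently_eq (z₀ := 0) (fun z _ => hg.analyticAt z)
    (fun z _ => hh.analyticAt z) ?_
  have ht : Tendsto (fun t : ℝ => (t : ℂ)) (𝓝[≠] 0) (𝓝[≠] 0) := by
    refine tendsto_nhdsWithin_iff.2 ⟨?_, ?_⟩
    · exact (Complex.continuous_ofReal.tendsto' 0 0 (by simp)).mono_left nhdsWithin_le_nhds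
    · filter_upwards [self_mem_nhdsWithin] with t h
      simpa using h
  exact ht.frequently (Eventually.of_forall heq).frequently

/-- Both sides are entire in `z` and agree on the real axis by the group law. -/
theorem IsEntireExtension.add_real (hα : ∀ s t a, α (s + t) a = α s (α t a)) {a : A} {g : ℂ → A}
    (h : IsEntireExtension α a g) (s : ℝ) (z : ℂ) : g (s + z) = α s (g z) := by
  refine congrFun (eq_of_eq_on_reals (g := fun z => g (s + z)) (h := fun z => α s (g z))
    (h.1.comp (differentiable_id.const_add _)) (differentiable_starAlgEquiv_comp _ h.1)
    fun t => ?_) z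
  rw [h.2, ← hα, ← h.2]; push_cast; rfl

/-- The real part of `iβz` acts through the flow, which is isometric, so the norm depends on `Re z`
alone and a compact segment controls the whole strip. -/
theorem IsEntireExtension.exists_bound (hα : ∀ s t a, α (s + t) a = α s (α t a)) {a : A}
    {g : ℂ → A} (h : IsEntireExtension α a g) (β : ℝ) :
    ∃ K, ∀ z : ℂ, z.re ∈ Set.Icc (0 : ℝ) 1 → ‖g (Complex.I * β * z)‖ ≤ K := by
  have hc : Continuous fun s : ℝ => g (Complex.I * β * s) :=
    h.1.continuous.comp (by fun_prop)
  obtain ⟨K, hK⟩ := (isCompact_Icc (a := (0 : ℝ)) (b := 1)).exists_bound_of_continuousOn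
    hc.continuousOn
  refine ⟨K, fun z hz => ?_⟩
  have hz' : Complex.I * β * z = ((-β * z.im : ℝ) : ℂ) + Complex.I * β * (z.re : ℝ) := by
    apply Complex.ext <;> simp
  rw [hz', h.add_real hα, norm_starAlgEquiv]
  exact hK _ hz

theorem IsEntireExtension.unique {a : A} {g h : ℂ → A}
    (hg : IsEntireExtension α a g) (hh : IsEntireExtension α a h) : g = h :=
  eq_of_eq_on_reals hg.1 hh.1 fun t => (hg.2 t).trans (hh.2 t).symm

theorem IsEntireExtension.flow (hα : ∀ s t a, α (s + t) a = α s (α t a)) {a : A} {g : ℂ → A}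
    (h : IsEntireExtension α a g) (s : ℝ) :
    IsEntireExtension α (α s a) fun z => g (s + z) :=
  ⟨h.1.comp (differentiable_id.const_add _), fun t => by
    rw [← hα, ← h.2, add_comm]; push_cast; rfl⟩

/-- The KMS condition on a dense invariant `⋆`-algebra of analytic elements entails it for all
analytic elements. -/
theorem IsKMSState.apply_mul (hα : ∀ s t a, α (s + t) a = α s (α t a)) {β : ℝ} {ω : WeakDual ℂ A}
    (hω : IsKMSState α β ω) {a : A} {g : ℂ → A} (hg : IsEntireExtension α a g) (b : A) :
    ω (a * b) = ω (b * g (Complex.I * β)) := by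
  obtain ⟨-, D, hD, hinv, hkms⟩ := hω
  have hωc : Continuous ω := ω.continuous
  -- Both sides are continuous in `b`, so `b` may be taken in `D`. The element `a` cannot be treated
  -- this way, because `g (iβ)` does not depend continuously on `a`.
  suffices h : ∀ b ∈ D, ω (a * b) = ω (b * g (Complex.I * β)) from
    congrFun (Continuous.ext_on hD (f := fun b => ω (a * b))
      (g := fun b => ω (b * g (Complex.I * β))) (hωc.comp (continuous_const.mul continuous_id))
      (hωc.comp (continuous_id.mul continuous_const)) h) b
  intro b hb
  obtain ⟨N, hN0, hN⟩ : ∃ N : ℝ, 0 ≤ N ∧ ∀ c, ‖ω c‖ ≤ N * ‖c‖ :=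
    ⟨_, norm_nonneg _, (WeakDual.toStrongDual ω).le_opNorm⟩
  have hdiff : ∀ {k : ℂ → A}, Differentiable ℂ k →
      Differentiable ℂ fun z => ω (b * k (Complex.I * β * z)) := fun hk =>
    (WeakDual.toStrongDual ω).differentiable.comp
      ((hk.comp (differentiable_id.const_mul _)).const_mul b)
  have hbound : ∀ {c : A} {k : ℂ → A}, IsEntireExtension α c k → ∃ K, ∀ z : ℂ,
      z.re ∈ Set.Icc (0 : ℝ) 1 → ‖ω (b * k (Complex.I * β * z))‖ ≤ K := fun hk => by
    obtain ⟨K, hK⟩ := hk.exists_bound hα β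
    refine ⟨N * (‖b‖ * K), fun z hz => (hN _).trans ?_⟩
    gcongr
    exact (norm_mul_le _ _).trans (by gcongr; exact hK z hz)
  -- The summand `1` keeps the factor positive when `N * ‖b‖ = 0`, and makes the choice of `c n`
  -- below force `c n → a` as well as the edge estimates.
  have hC : 0 < N * ‖b‖ + 1 := by positivity
  have happrox : ∀ n : ℕ, ∃ c ∈ D, (N * ‖b‖ + 1) * ‖a - c‖ ≤ 1 / ((n : ℝ) + 1) := by
    intro n
    obtain ⟨c, hc, hac⟩ := Metric.mem_closure_iff.1 (hD a)
      (1 / ((n : ℝ) + 1) / (N * ‖b‖ + 1)) (by positivity)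
    rw [dist_eq_norm, lt_div_iff₀ hC] at hac
    exact ⟨c, hc, by rw [mul_comm]; exact hac.le⟩
  choose c hcD hc using happrox
  choose k hk hkω using fun n => hkms (c n) (hcD n)
  have hC' : ∀ n, N * (‖b‖ * ‖a - c n‖) ≤ 1 / ((n : ℝ) + 1) := fun n =>
    le_trans (by nlinarith [norm_nonneg (a - c n)]) (hc n)
  obtain ⟨KH, hKH⟩ := hbound hg
  -- On the right edge the KMS condition for the translate `α_t(c n)`, which lies in `D`, removes
  -- the complex time. Uniqueness of entire extensions identifies the one supplied for the translate
  -- with a translate of `k n`.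
  have hright : ∀ n (z : ℂ), z.re = 1 →
      ω (b * k n (Complex.I * β * z)) = ω (α (-β * z.im) (c n) * b) := by
    intro n z hz
    obtain ⟨k', hk', hkω'⟩ := hkms _ (hinv (-β * z.im) _ (hcD n))
    rw [hkω' b hb, hk'.unique ((hk n).flow hα _)]
    congr 3
    apply Complex.ext <;> simp [hz]
  have hlim := tendsto_at_one_of_strip_edges
    (H := fun z => ω (b * g (Complex.I * β * z)))
    (G := fun n z => ω (b * k n (Complex.I * β * z)))
    (hdiff hg.1) (fun n => hdiff (hk n).1) hKH (fun n => hbound (hk n))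
    (ε := fun n => 1 / ((n : ℝ) + 1)) tendsto_one_div_add_atTop_nhds_zero_nat
    (fun n => by positivity)
    (fun m n h => one_div_le_one_div_of_le (by positivity) (by exact_mod_cast Nat.succ_le_succ h))
    (fun n z hz => by
      have hz' : Complex.I * β * z = ((-β * z.im : ℝ) : ℂ) := by
        apply Complex.ext <;> simp [hz]
      rw [hz', hg.2, (hk n).2, ← map_sub, ← mul_sub, ← map_sub]
      refine (hN _).trans (le_trans ?_ (hC' n))
      gcongr
      exact (norm_mul_le _ _).trans_eq (by rw [norm_starAlgEquiv]))
    (fun n m z hz => by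
      rw [hright n z hz, hright m z hz, ← map_sub, ← sub_mul, ← map_sub]
      refine (hN _).trans ?_
      calc _ ≤ N * (‖b‖ * (‖a - c n‖ + ‖a - c m‖)) := by
            gcongr
            refine (norm_mul_le _ _).trans ?_
            rw [norm_starAlgEquiv, mul_comm]
            gcongr
            calc ‖c n - c m‖ = ‖(a - c m) - (a - c n)‖ := by congr 1; abel
              _ ≤ _ := (norm_sub_le _ _).trans_eq (add_comm _ _)
        _ ≤ _ := by linarith [hC' n, hC' m])
  have hlim' : Tendsto (fun n => ω (c n * b)) atTop (𝓝 (ω (a * b))) := by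
    have hca : Tendsto c atTop (𝓝 a) := by
      rw [tendsto_iff_norm_sub_tendsto_zero]
      refine squeeze_zero (fun _ => norm_nonneg _) (fun n => ?_)
        tendsto_one_div_add_atTop_nhds_zero_nat
      rw [norm_sub_rev]
      exact le_trans (by nlinarith [norm_nonneg (a - c n), mul_nonneg hN0 (norm_nonneg b)]) (hc n)
    exact (hωc.tendsto _).comp (hca.mul_const b)
  refine tendsto_nhds_unique hlim' ?_
  simpa only [mul_one, ← hkω _ b hb] using hlim

/-- The KMS states form a convex set. -/
theorem convex_kmsStates (hα : ∀ s t a, α (s + t) a = α s (α t a)) (β : ℝ) :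
    Convex ℝ (kmsStates α β) := by
  intro ω₁ h₁ ω₂ h₂ s t hs ht hst
  have happ : ∀ c, (s • ω₁ + t • ω₂ : WeakDual ℂ A) c = (s : ℂ) * ω₁ c + (t : ℂ) * ω₂ c :=
    fun c => rfl
  -- The algebra of `ω₁` serves for the combination: by `apply_mul`, `ω₂` satisfies the condition
  -- there too.
  obtain ⟨D, hD, hinv, hkms⟩ := h₁.2
  refine ⟨⟨fun a => ?_, ?_⟩, D, hD, hinv, fun a ha => ?_⟩
  · rw [happ]
    exact add_nonneg (mul_nonneg (by exact_mod_cast hs) (h₁.1.1 a))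
      (mul_nonneg (by exact_mod_cast ht) (h₂.1.1 a))
  · rw [happ, h₁.1.2, h₂.1.2, mul_one, mul_one]
    exact_mod_cast hst
  · obtain ⟨g, hg, -⟩ := hkms a ha
    exact ⟨g, hg, fun b _ => by rw [happ, happ, h₁.apply_mul hα hg, h₂.apply_mul hα hg]⟩

/-- The elements `a` with an entire extension `g` of their orbit such that
`ω(g(z) b) = ω(b g(z + iβ))` for all `z` and all `b`. -/
def kmsSubalgebra (α : ℝ → A ≃⋆ₐ[ℂ] A) (β : ℝ) (ω : WeakDual ℂ A)
    (hstar : ∀ a, ω (star a) = star (ω a)) : NonUnitalStarSubalgebra ℂ A where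
  carrier := {a | ∃ g, IsEntireExtension α a g ∧
    ∀ z b, ω (g z * b) = ω (b * g (z + Complex.I * β))}
  add_mem' := by
    rintro a b ⟨g, hg, hgω⟩ ⟨h, hh, hhω⟩
    refine ⟨fun z => g z + h z, ⟨hg.1.add hh.1, fun t => by
      simp only [hg.2, hh.2, map_add]⟩,
      fun z c => ?_⟩
    rw [add_mul, mul_add, map_add, map_add, hgω, hhω]
  zero_mem' := ⟨fun _ => 0, ⟨differentiable_const _, fun t => by simp⟩, fun z b => by simp⟩
  mul_mem' := by
    rintro a b ⟨g, hg, hgω⟩ ⟨h, hh, hhω⟩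
    refine ⟨fun z => g z * h z, ⟨hg.1.mul hh.1, fun t => by
      simp only [hg.2, hh.2, map_mul]⟩,
      fun z c => ?_⟩
    rw [mul_assoc, hgω, mul_assoc, hhω, mul_assoc]
  smul_mem' := by
    rintro r a ⟨g, hg, hgω⟩
    refine ⟨fun z => r • g z, ⟨hg.1.const_smul r, fun t => by
      simp only [hg.2, map_smul]⟩,
      fun z c => ?_⟩
    rw [smul_mul_assoc, mul_smul_comm, map_smul, map_smul, hgω]
  star_mem' := by
    rintro a ⟨g, hg, hgω⟩
    refine ⟨fun z => star (g (star z)), ⟨fun z => ?_, fun t => ?_⟩, fun z c => ?_⟩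
    · have h := (hg.1 (star z)).star_star
      rwa [star_star] at h
    · have ht : star (t : ℂ) = t := Complex.conj_ofReal t
      simp only [ht, hg.2, map_star]
    -- Conjugation turns `iβ` into `-iβ`, hence the identity for `a` is used at a point shifted back
    -- by `iβ`.
    · have h := hgω (star z - Complex.I * β) (star c)
      rw [sub_add_cancel] at h
      calc ω (star (g (star z)) * c) = star (ω (star c * g (star z))) := by
            rw [← hstar, star_mul, star_star]
        _ = ω (c * star (g (star z - Complex.I * β))) := by
            rw [← h, ← hstar, star_mul, star_star]
        _ = _ := by simp [sub_eq_add_neg]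

/-- The identity in `kmsSubalgebra` holds at every complex time, which makes that algebra invariant
under the flow; its case `z = 0` is the KMS condition. -/
theorem isKMSState_of_dense (hα : ∀ s t a, α (s + t) a = α s (α t a)) {β : ℝ}
    {ω : WeakDual ℂ A} (hω : IsState ω) (hstar : ∀ a, ω (star a) = star (ω a))
    (hD : Dense (kmsSubalgebra α β ω hstar : Set A)) : IsKMSState α β ω := by
  refine ⟨hω, kmsSubalgebra α β ω hstar, hD, ?_, ?_⟩
  · rintro t a ⟨g, hg, hgω⟩
    refine ⟨_, hg.flow hα t, fun z b => ?_⟩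
    rw [hgω, add_assoc]
  · rintro a ⟨g, hg, hgω⟩
    refine ⟨g, hg, fun b _ => ?_⟩
    -- That `α 0` is the identity is not assumed; it follows from the group law and injectivity.
    have h0 : g 0 = a := by
      have h := hα 0 0 a
      rw [add_zero] at h
      rw [← Complex.ofReal_zero, hg.2, ← (α 0).injective h]
    rw [← h0, hgω, zero_add]

end AbstractKMS

/-! ### The flow on the crossed product: group law and complex phases -/

namespace CrossedProduct

section Phase

variable {X : Type u} [TopologicalSpace X]

theorem phase_add (F : C(X, ℝ)) (s t : ℝ) : phase F (s + t) = phase F s * phase F t := by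
  apply Subtype.ext
  ext x
  change Complex.exp _ = Complex.exp _ * Complex.exp _
  rw [← Complex.exp_add]
  congr 1
  push_cast
  ring

/-- The function `e^{-izF}`. -/
def complexPhase (F : C(X, ℝ)) (z : ℂ) : C(X, ℂ) :=
  ⟨fun x => Complex.exp (-(Complex.I * z * F x)), by fun_prop⟩

theorem complexPhase_add (F : C(X, ℝ)) (z w : ℂ) :
    complexPhase F (z + w) = complexPhase F z * complexPhase F w := by
  ext x
  change Complex.exp _ = Complex.exp _ * Complex.exp _
  rw [← Complex.exp_add]
  congr 1
  ring

end Phase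

variable {X : Type u} [TopologicalSpace X] [CompactSpace X] {φ : X ≃ₜ X}

theorem flow_add (F : C(X, ℝ)) (s t : ℝ) (a : CrossedProduct φ) :
    flow φ F (s + t) a = flow φ F s (flow φ F t a) := by
  change twist φ (phase F (s + t)) a = twist φ (phase F s) (twist φ (phase F t) a)
  rw [phase_add, ← twist_twist]
  rfl

/-! ### Algebraic properties of the conditional expectation -/

theorem E_apply (a : CrossedProduct φ) (x : X) :
    E φ a x = reg φ x a (basisVec 0) (⟨0⟩ : ULift.{u} ℤ) := rfl

theorem E_ι_mul (f : C(X, ℂ)) (a : CrossedProduct φ) : E φ (ι φ f * a) = f * E φ a := by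
  ext x
  rw [E_apply, map_mul, mul_apply_eq_comp, reg_ι_apply]
  rfl

theorem E_mul_ι (f : C(X, ℂ)) (a : CrossedProduct φ) : E φ (a * ι φ f) = E φ a * f := by
  ext x
  rw [E_apply, map_mul, mul_apply_eq_comp, reg_ι_basisVec, map_smul]
  exact mul_comm _ _

theorem E_ι (f : C(X, ℂ)) : E φ (ι φ f) = f := by
  simpa using E_ι_mul_U_zpow (φ := φ) f 0

theorem E_one : E φ (1 : CrossedProduct φ) = 1 := by
  rw [← map_one (ι φ), E_ι]

theorem ellTwo_apply_eq_inner (ξ : ellTwo.{u}) :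
    ξ (⟨0⟩ : ULift.{u} ℤ) = inner ℂ (basisVec 0) ξ := by
  rw [basisVec, lp.inner_single_left]
  simp

theorem E_star (a : CrossedProduct φ) : E φ (star a) = star (E φ a) := by
  ext x
  rw [E_apply, ellTwo_apply_eq_inner, map_star, ContinuousLinearMap.star_eq_adjoint,
    ContinuousLinearMap.adjoint_inner_right, ContinuousMap.star_apply, E_apply,
    ellTwo_apply_eq_inner]
  exact (inner_conj_symm _ _).symm

/-- Evaluating `E` at `x` is the vector functional of `δ₀`, so the value is `‖reg φ x a δ₀‖²`. -/
theorem E_star_mul_self_apply_nonneg (a : CrossedProduct φ) (x : X) :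
    0 ≤ E φ (star a * a) x := by
  rw [E_apply, ellTwo_apply_eq_inner, map_mul, map_star, ContinuousLinearMap.star_eq_adjoint,
    mul_apply_eq_comp, ContinuousLinearMap.adjoint_inner_right, inner_self_eq_norm_sq_to_K]
  exact pow_nonneg (Complex.zero_le_real.2 (norm_nonneg (reg φ x a (basisVec 0)))) 2

theorem norm_basisVec (n : ℤ) : ‖basisVec.{u} n‖ = 1 := by
  rw [basisVec, lp.norm_single (by norm_num)]
  simp

theorem norm_E_apply_le (a : CrossedProduct φ) (x : X) : ‖E φ a x‖ ≤ ‖a‖ := by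
  rw [E_apply]
  refine (lp.norm_apply_le_norm (by norm_num) _ _).trans ((norm_reg_apply_le x a _).trans_eq ?_)
  rw [norm_basisVec, mul_one]

/-- Moving the base point along its orbit relabels `ℓ²(ℤ)` by the shift. Both sides are
multiplicative in `a`, so generators suffice; on `U` and `U⋆` the representation does not depend on
the point. -/
theorem reg_symm_eq (a : CrossedProduct φ) (x : X) :
    reg φ (φ.symm x) a =
      reg φ x ((U φ : CrossedProduct φ) * a * star (U φ : CrossedProduct φ)) := by
  have hc : ∀ y, Continuous (reg φ y) := fun y =>
    (NonUnitalStarAlgHom.instContinuousLinearMapClassComplex).map_continuous (reg φ y)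
  have hU : star (U φ : CrossedProduct φ) * (U φ : CrossedProduct φ) = 1 :=
    Unitary.coe_star_mul_self _
  have hU' : (U φ : CrossedProduct φ) * star (U φ : CrossedProduct φ) = 1 :=
    Unitary.coe_mul_star_self _
  refine closed_induction (p := fun a => reg φ (φ.symm x) a = reg φ x
      ((U φ : CrossedProduct φ) * a * star (U φ : CrossedProduct φ)))
    (isClosed_eq (hc _) ((hc _).comp (by fun_prop))) (fun f => ?_) ?_ ?_ ?_ ?_ a
  · rw [U_mul_ι_mul_star]
    refine ContinuousLinearMap.ext fun ξ => lp.ext (funext fun n => ?_)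
    rw [reg_ι_apply, reg_ι_apply]
    congr 1
    change f _ = f (φ.symm ((φ ^ n.down) x))
    congr 1
    change (φ ^ n.down * φ⁻¹) x = (φ⁻¹ * φ ^ n.down) x
    rw [← zpow_neg_one, ← zpow_add, ← zpow_add, add_comm]
  · rw [mul_assoc, hU', mul_one]; rfl
  · rw [hU', one_mul]; rfl
  · intro a b ha hb
    rw [mul_add, add_mul, map_add, map_add, ha, hb]
  · intro a b ha hb
    rw [map_mul, ha, hb, ← map_mul]
    congr 1
    calc (U φ : CrossedProduct φ) * a * star (U φ : CrossedProduct φ) *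
          ((U φ : CrossedProduct φ) * b * star (U φ : CrossedProduct φ))
        = (U φ : CrossedProduct φ) * a * (star (U φ : CrossedProduct φ) *
          (U φ : CrossedProduct φ)) * b * star (U φ : CrossedProduct φ) := by
          simp only [mul_assoc]
      _ = _ := by rw [hU, mul_one, mul_assoc (U φ : CrossedProduct φ) a b]

/-- Equivariance of `E` under conjugation by `U`, applied to `U a = U (a U) U⋆`. This is where
conformality will enter. -/
theorem E_U_mul_apply (a : CrossedProduct φ) (x : X) :
    E φ ((U φ : CrossedProduct φ) * a) x = E φ (a * (U φ : CrossedProduct φ)) (φ.symm x) := by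
  have h : (U φ : CrossedProduct φ) * (a * (U φ : CrossedProduct φ)) *
      star (U φ : CrossedProduct φ) = (U φ : CrossedProduct φ) * a := by
    rw [mul_assoc, mul_assoc, Unitary.mul_star_self_of_mem (U φ).2, mul_one]
  rw [E_apply (a * _), reg_symm_eq, h]
  rfl

/-! ### Density of the polynomials in `U` -/

theorem U_zpow_mul_ι (n : ℤ) (f : C(X, ℂ)) :
    ((U φ ^ n : unitary (CrossedProduct φ)) : CrossedProduct φ) * ι φ f =
      ι φ (f.comp ((φ ^ (-n) : X ≃ₜ X) : C(X, X))) *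
        ((U φ ^ n : unitary (CrossedProduct φ)) : CrossedProduct φ) := by
  have hU : ∀ f : C(X, ℂ), (U φ : CrossedProduct φ) * ι φ f =
      ι φ (f.comp (φ.symm : C(X, X))) * (U φ : CrossedProduct φ) := fun f => by
    rw [← U_mul_ι_mul_star, mul_assoc _ (star _), Unitary.coe_star_mul_self, mul_one]
  have hU' : ∀ f : C(X, ℂ), ((U φ)⁻¹ : unitary (CrossedProduct φ)) * ι φ f =
      ι φ (f.comp (φ : C(X, X))) * ((U φ)⁻¹ : unitary (CrossedProduct φ)) := fun f => by
    have h := hU (f.comp (φ : C(X, X)))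
    have hf : (f.comp (φ : C(X, X))).comp (φ.symm : C(X, X)) = f := by ext x; simp
    rw [hf] at h
    have h1 : ((U φ : unitary (CrossedProduct φ)) : CrossedProduct φ) *
        ((U φ)⁻¹ : unitary (CrossedProduct φ)) = 1 := by
      rw [← Submonoid.coe_mul, mul_inv_cancel, Submonoid.coe_one]
    have h2 : (((U φ)⁻¹ : unitary (CrossedProduct φ)) : CrossedProduct φ) *
        (U φ : CrossedProduct φ) = 1 := by
      rw [← Submonoid.coe_mul, inv_mul_cancel, Submonoid.coe_one]
    rw [← mul_one (ι φ f), ← h1, ← mul_assoc (ι φ f), ← h, ← mul_assoc, ← mul_assoc, h2, one_mul]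
  induction n generalizing f with
  | zero =>
    have hf : f.comp ((φ ^ (-0 : ℤ) : X ≃ₜ X) : C(X, X)) = f := by
      ext x; rw [neg_zero, zpow_zero]; rfl
    rw [hf, zpow_zero, Submonoid.coe_one, one_mul, mul_one]
  | succ j ih =>
    have hf : (f.comp (φ.symm : C(X, X))).comp ((φ ^ (-(j : ℤ)) : X ≃ₜ X) : C(X, X)) =
        f.comp ((φ ^ (-((j : ℤ) + 1)) : X ≃ₜ X) : C(X, X)) := by
      ext x
      change f ((φ⁻¹ * φ ^ (-(j : ℤ))) x) = f ((φ ^ (-((j : ℤ) + 1))) x)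
      rw [neg_add_rev, zpow_add, zpow_neg_one]
    rw [zpow_add_one, Submonoid.coe_mul, mul_assoc, hU, ← mul_assoc, ih, mul_assoc, hf]
  | pred j ih =>
    have hf : (f.comp (φ : C(X, X))).comp ((φ ^ (-(-(j : ℤ))) : X ≃ₜ X) : C(X, X)) =
        f.comp ((φ ^ (-(-(j : ℤ) - 1)) : X ≃ₜ X) : C(X, X)) := by
      ext x
      change f ((φ * φ ^ (-(-(j : ℤ)))) x) = f ((φ ^ (-(-(j : ℤ) - 1))) x)
      rw [← zpow_one_add]
      congr 3
      ring
    rw [zpow_sub_one, Submonoid.coe_mul, mul_assoc, hU', ← mul_assoc, ih, mul_assoc, hf]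

/-- The linear span of the elements `f Uⁿ`. -/
def polynomials (φ : X ≃ₜ X) : Submodule ℂ (CrossedProduct φ) :=
  Submodule.span ℂ (Set.range fun p : C(X, ℂ) × ℤ =>
    ι φ p.1 * ((U φ ^ p.2 : unitary (CrossedProduct φ)) : CrossedProduct φ))

theorem ι_mul_U_zpow_mem (f : C(X, ℂ)) (n : ℤ) :
    ι φ f * ((U φ ^ n : unitary (CrossedProduct φ)) : CrossedProduct φ) ∈ polynomials φ :=
  Submodule.subset_span ⟨(f, n), rfl⟩

theorem mul_mem_polynomials {a b : CrossedProduct φ} (ha : a ∈ polynomials φ)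
    (hb : b ∈ polynomials φ) : a * b ∈ polynomials φ := by
  have h := Submodule.mul_mem_mul ha hb
  rw [polynomials, Submodule.span_mul_span] at h
  refine Submodule.span_le.2 ?_ h
  rintro _ ⟨_, ⟨⟨f, n⟩, rfl⟩, _, ⟨⟨g, m⟩, rfl⟩, rfl⟩
  have : ι φ f * ((U φ ^ n : unitary (CrossedProduct φ)) : CrossedProduct φ) *
      (ι φ g * ((U φ ^ m : unitary (CrossedProduct φ)) : CrossedProduct φ)) =
      ι φ (f * g.comp ((φ ^ (-n) : X ≃ₜ X) : C(X, X))) *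
        ((U φ ^ (n + m) : unitary (CrossedProduct φ)) : CrossedProduct φ) := by
    rw [mul_assoc, ← mul_assoc _ (ι φ g), U_zpow_mul_ι, map_mul, zpow_add, Submonoid.coe_mul]
    simp only [mul_assoc]
  simp only [this]
  exact ι_mul_U_zpow_mem _ _

theorem dense_polynomials : Dense (polynomials φ : Set (CrossedProduct φ)) := by
  intro a
  refine closed_induction (p := fun a => a ∈ closure (polynomials φ : Set (CrossedProduct φ)))
    isClosed_closure (fun f => subset_closure ?_) (subset_closure ?_) (subset_closure ?_)
    (fun a b ha hb => ?_) (fun a b ha hb => ?_) a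
  · simpa using ι_mul_U_zpow_mem (φ := φ) f 0
  · simpa using ι_mul_U_zpow_mem (φ := φ) 1 1
  · have h := ι_mul_U_zpow_mem (φ := φ) 1 (-1)
    rwa [map_one, one_mul, zpow_neg_one] at h
  · exact map_mem_closure₂ continuous_add ha hb fun _ hc _ hd => add_mem hc hd
  · exact map_mem_closure₂ continuous_mul ha hb fun _ hc _ hd => mul_mem_polynomials hc hd

/-! ### The entire extension of the orbit of `U` -/

/-- The function is the exponential of `-izF` in the Banach algebra `C(X)`, which gives
differentiability in the sup norm and not merely at each point. -/
theorem differentiable_complexPhase (F : C(X, ℝ)) : Differentiable ℂ (complexPhase F) := by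
  let G : C(X, ℂ) := ⟨fun x => F x, by fun_prop⟩
  have h : complexPhase F = fun z => NormedSpace.exp ((-(Complex.I * z)) • G) := by
    funext z
    ext x
    have h1 := NormedSpace.map_exp (ContinuousMap.evalAlgHom ℂ ℂ x)
      (ContinuousEvalConst.continuous_eval_const x) ((-(Complex.I * z)) • G)
    change _ = ContinuousMap.evalAlgHom ℂ ℂ x (NormedSpace.exp ((-(Complex.I * z)) • G))
    rw [h1, ← Complex.exp_eq_exp_ℂ]
    change Complex.exp _ = Complex.exp (-(Complex.I * z) * (F x : ℂ))
    rw [neg_mul]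
  rw [h]
  have h2 : Differentiable ℂ (NormedSpace.exp : C(X, ℂ) → C(X, ℂ)) := fun y =>
    (NormedSpace.exp_analytic y).differentiableAt
  exact h2.comp (by fun_prop)

theorem isEntireExtension_ι (F : C(X, ℝ)) (f : C(X, ℂ)) :
    IsEntireExtension (flow φ F) (ι φ f) fun _ => ι φ f :=
  ⟨differentiable_const _, fun _ => rfl⟩

theorem isEntireExtension_U (F : C(X, ℝ)) :
    IsEntireExtension (flow φ F) (U φ : CrossedProduct φ)
      fun z => (U φ : CrossedProduct φ) * ι φ (complexPhase F z) := by
  refine ⟨Differentiable.const_mul ?_ _, fun _ => rfl⟩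
  have hc : Continuous (ι φ) :=
    (NonUnitalStarAlgHom.instContinuousLinearMapClassComplex).map_continuous (ι φ)
  exact (ContinuousLinearMap.differentiable (⟨(ι φ).toAlgHom.toLinearMap, hc⟩ :
    C(X, ℂ) →L[ℂ] CrossedProduct φ)).comp (differentiable_complexPhase F)

end CrossedProduct

/-! ### Riesz representation of states on `C(X)` -/

section Measures

variable {X : Type*} [TopologicalSpace X]

/-- A real continuous function as a complex one. -/
def ofRealFun (f : C(X, ℝ)) : C(X, ℂ) := ⟨fun x => (f x : ℂ), by fun_prop⟩

theorem ofRealFun_apply (f : C(X, ℝ)) (x : X) : ofRealFun f x = (f x : ℂ) := rfl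

variable [CompactSpace X]

theorem integrable_continuousMap [MeasurableSpace X] [BorelSpace X] {E : Type*}
    [NormedAddCommGroup E] [SecondCountableTopologyEither X E] (m : Measure X)
    [IsFiniteMeasure m] (f : C(X, E)) : Integrable (fun x => f x) m := by
  refine Integrable.of_bound f.continuous.aestronglyMeasurable ‖f‖ ?_
  exact ae_of_all _ f.norm_coe_le_norm

variable [T2Space X]

/-- A state on `C(X)` is given by a probability measure. -/
theorem exists_probabilityMeasure_of_state [MeasurableSpace X] [BorelSpace X]
    (τ : C(X, ℂ) →ₗ[ℂ] ℂ) (hpos : ∀ f, 0 ≤ τ (star f * f)) (hone : τ 1 = 1) :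
    ∃ m : ProbabilityMeasure X, ∀ f : C(X, ℂ), τ f = ∫ x, f x ∂(m : Measure X) := by
  have hnn : ∀ f : C(X, ℝ), 0 ≤ f → 0 ≤ τ (ofRealFun f) := by
    intro f hf
    have h : ofRealFun f = star (ofRealFun ⟨fun x => √(f x), by fun_prop⟩) *
        ofRealFun ⟨fun x => √(f x), by fun_prop⟩ := by
      ext x
      simp only [ContinuousMap.mul_apply, ContinuousMap.star_apply, ofRealFun_apply,
        ContinuousMap.coe_mk, Complex.star_def, Complex.conj_ofReal]
      rw [← Complex.ofReal_mul, Real.mul_self_sqrt (show 0 ≤ f x from hf x)]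
    rw [h]
    exact hpos _
  have hreal : ∀ f : C(X, ℝ), (τ (ofRealFun f)).im = 0 := by
    intro f
    -- Adding the constant `‖f‖` makes `f` nonnegative and changes `τ` by a real number.
    have h1 := hnn (f + ContinuousMap.const X ‖f‖) fun x => by
      have := neg_le_of_abs_le (f.norm_coe_le_norm x)
      change 0 ≤ f x + ‖f‖
      linarith
    have h2 : ofRealFun (f + ContinuousMap.const X ‖f‖) = ofRealFun f + (‖f‖ : ℂ) • 1 := by
      ext x; simp [ofRealFun_apply]
    rw [h2, map_add, map_smul, hone] at h1
    simpa using (Complex.nonneg_iff.1 h1).2.symm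
  -- On a compact space every continuous function has compact support, so the real
  -- Riesz–Markov–Kakutani theorem applies.
  let L : CompactlySupportedContinuousMap X ℝ →ₗ[ℝ] ℝ :=
    { toFun := fun f => (τ (ofRealFun f)).re
      map_add' := fun f g => by
        have : ofRealFun (f + g : CompactlySupportedContinuousMap X ℝ) =
            ofRealFun (f : C(X, ℝ)) + ofRealFun (g : C(X, ℝ)) := by ext x; simp [ofRealFun_apply]
        rw [this, map_add, Complex.add_re]
      map_smul' := fun r f => by
        have : ofRealFun (r • f : CompactlySupportedContinuousMap X ℝ) =
            (r : ℂ) • ofRealFun (f : C(X, ℝ)) := by ext x; simp [ofRealFun_apply]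
        rw [this, map_smul]; simp }
  let Λ : CompactlySupportedContinuousMap X ℝ →ₚ[ℝ] ℝ :=
    PositiveLinearMap.mk₀ L fun f hf => (Complex.nonneg_iff.1 (hnn f hf)).1
  have hint : ∀ f : C(X, ℝ), ∫ x, f x ∂(RealRMK.rieszMeasure Λ) = (τ (ofRealFun f)).re :=
    fun f => RealRMK.integral_rieszMeasure Λ
      (CompactlySupportedContinuousMap.continuousMapEquiv f)
  have hfin : IsFiniteMeasure (RealRMK.rieszMeasure Λ) := inferInstance
  have hprob : IsProbabilityMeasure (RealRMK.rieszMeasure Λ) := by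
    have h := hint 1
    have h1 : ofRealFun (1 : C(X, ℝ)) = 1 := by ext x; simp [ofRealFun_apply]
    rw [h1, hone] at h
    simp only [ContinuousMap.one_apply, integral_const, smul_eq_mul, mul_one,
      Complex.one_re] at h
    exact isProbabilityMeasure_iff_real.2 h
  refine ⟨⟨RealRMK.rieszMeasure Λ, hprob⟩, fun f => ?_⟩
  let fr : C(X, ℝ) := ⟨fun x => (f x).re, by fun_prop⟩
  let fi : C(X, ℝ) := ⟨fun x => (f x).im, by fun_prop⟩
  have hf : f = ofRealFun fr + Complex.I • ofRealFun fi := by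
    ext x
    change f x = ((f x).re : ℂ) + Complex.I * ((f x).im : ℂ)
    rw [mul_comm, Complex.re_add_im]
  have hτ : ∀ g : C(X, ℝ), τ (ofRealFun g) = ∫ x, ofRealFun g x ∂(RealRMK.rieszMeasure Λ) := by
    intro g
    simp only [ofRealFun_apply]
    rw [integral_complex_ofReal, hint]
    exact Complex.ext (by simp) (by simp [hreal])
  change _ = ∫ x, f x ∂(RealRMK.rieszMeasure Λ)
  rw [hf, map_add, map_smul, hτ, hτ]
  simp only [ContinuousMap.add_apply]
  rw [integral_add (integrable_continuousMap _ (ofRealFun fr))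
    (integrable_continuousMap _ (Complex.I • ofRealFun fi))]
  congr 1
  exact (integral_smul _ _).symm

end Measures

/-! ### Conformality as an identity of integrals -/

section MetricMeasures

variable {X : Type*} [MetricSpace X] [MeasurableSpace X] [BorelSpace X]

variable {φ : X ≃ₜ X} {F : C(X, ℝ)} {β : ℝ}

/-- Since `φ(B)` is the preimage of `B` under `φ⁻¹`, the condition on all Borel sets is one equality
of measures, which continuous functions can test. -/
theorem mem_conformalMeasures_iff_map_eq {m : ProbabilityMeasure X} :
    m ∈ conformalMeasures φ F β ↔ (m : Measure X).map φ.symm =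
      (m : Measure X).withDensity fun x => ENNReal.ofReal (Real.exp (β * F x)) := by
  rw [Measure.ext_iff]
  refine forall₂_congr fun B hB => ?_
  rw [Measure.map_apply φ.symm.measurable hB, withDensity_apply _ hB,
    φ.image_eq_preimage_symm]

theorem measure_ext_of_integral_eq {μ ν : Measure X} [IsFiniteMeasure μ] [IsFiniteMeasure ν]
    (h : ∀ f : C(X, ℂ), ∫ x, f x ∂μ = ∫ x, f x ∂ν) : μ = ν := by
  refine ext_of_forall_integral_eq_of_IsFiniteMeasure fun f => ?_
  have hf := h (ofRealFun f.toContinuousMap)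
  simp only [ofRealFun_apply] at hf
  rw [integral_complex_ofReal, integral_complex_ofReal] at hf
  exact_mod_cast hf

variable [CompactSpace X]

/-- A probability measure is `e^{βF}`-conformal if and only if
`∫ f ∘ φ⁻¹ dm = ∫ e^{βF} f dm` for all continuous `f`. -/
theorem mem_conformalMeasures_iff {m : ProbabilityMeasure X} :
    m ∈ conformalMeasures φ F β ↔ ∀ f : C(X, ℂ), ∫ x, f (φ.symm x) ∂(m : Measure X) =
      ∫ x, (Real.exp (β * F x) : ℂ) * f x ∂(m : Measure X) := by
  have hmeas : Measurable fun x => ENNReal.ofReal (Real.exp (β * F x)) := by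
    have : Continuous fun x => Real.exp (β * F x) := by fun_prop
    exact this.measurable.ennreal_ofReal
  have hmap : ∀ f : C(X, ℂ), ∫ x, f x ∂((m : Measure X).map φ.symm) =
      ∫ x, f (φ.symm x) ∂(m : Measure X) := fun f =>
    φ.symm.measurableEmbedding.integral_map _
  have hden : ∀ f : C(X, ℂ), ∫ x, f x ∂((m : Measure X).withDensity
      fun x => ENNReal.ofReal (Real.exp (β * F x))) =
      ∫ x, (Real.exp (β * F x) : ℂ) * f x ∂(m : Measure X) := fun f => by
    rw [integral_withDensity_eq_integral_toReal_smul hmeas (ae_of_all _ fun _ =>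
      ENNReal.ofReal_lt_top)]
    refine integral_congr_ae (ae_of_all _ fun x => ?_)
    simp only [ENNReal.toReal_ofReal (Real.exp_nonneg _), Complex.real_smul]
  rw [mem_conformalMeasures_iff_map_eq]
  refine ⟨fun h f => ?_, fun h => ?_⟩
  · rw [← hmap, h, hden]
  · have h1 : IsFiniteMeasure ((m : Measure X).map φ.symm) := inferInstance
    -- The density is continuous on a compact space, hence integrable; finiteness is needed for
    -- integrals of continuous functions to determine the measure.
    have h2 : IsFiniteMeasure ((m : Measure X).withDensity
        fun x => ENNReal.ofReal (Real.exp (β * F x))) := by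
      refine isFiniteMeasure_withDensity_ofReal ?_
      exact (integrable_continuousMap (m : Measure X)
        ⟨fun x => Real.exp (β * F x), by fun_prop⟩).2
    exact measure_ext_of_integral_eq fun f => by rw [hmap, hden, h]

end MetricMeasures

/-! ### Consequences of minimality -/

section Dynamics

variable {X : Type*} [MetricSpace X] {φ : X ≃ₜ X}

/-- A minimal homeomorphism of an infinite space has no periodic points. -/
theorem IsMinimalHomeo.zpow_apply_ne [Infinite X] (hφ : IsMinimalHomeo φ) {n : ℤ} (hn : n ≠ 0)
    (x : X) : (φ ^ n) x ≠ x := by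
  intro h
  have hk : ∀ k : ℤ, (φ ^ (n * k)) x = x := by
    intro k
    rw [zpow_mul]
    induction k with
    | zero => rfl
    | succ j ih => rw [zpow_add_one]; change ((φ ^ n) ^ (j : ℤ)) ((φ ^ n) x) = x; rw [h, ih]
    | pred j ih =>
      have h' : ((φ ^ n)⁻¹) x = x := (φ ^ n).symm_apply_eq.2 h.symm
      rw [zpow_sub_one]; change ((φ ^ n) ^ (-(j : ℤ))) ((φ ^ n)⁻¹ x) = x; rw [h', ih]
  -- A period `n` reduces exponents modulo `|n|`. The orbit is then finite, hence closed, and being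
  -- dense it is the whole infinite space.
  have hfin : (Set.range fun k : ℤ => (φ ^ k) x).Finite := by
    refine ((Set.finite_Ico (0 : ℤ) |n|).image fun k : ℤ => (φ ^ k) x).subset ?_
    rintro _ ⟨k, rfl⟩
    refine ⟨k % n, ⟨Int.emod_nonneg k hn, Int.emod_lt_abs k hn⟩, ?_⟩
    change (φ ^ (k % n)) x = (φ ^ k) x
    conv_rhs => rw [← Int.emod_add_mul_ediv k n, zpow_add]
    change _ = (φ ^ (k % n)) ((φ ^ (n * (k / n))) x)
    rw [hk]
  have huniv := (hφ x).closure_eq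
  rw [hfin.isClosed.closure_eq] at huniv
  exact Set.infinite_univ (huniv ▸ hfin)

/-- The functions `g ∘ ψ - g` generate `C(X)` as an ideal when `ψ` has no fixed points. -/
theorem span_comp_sub_eq_top [CompactSpace X] (ψ : C(X, X)) (hψ : ∀ x, ψ x ≠ x) :
    Ideal.span (Set.range fun g : C(X, ℂ) => g.comp ψ - g) = ⊤ := by
  by_contra hne
  -- A maximal ideal of `C(X)` consists of the functions vanishing at some point `x`; the distance
  -- to `x` then contradicts `ψ x ≠ x`.
  obtain ⟨M, hM, hle⟩ := Ideal.exists_le_maximal _ hne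
  obtain ⟨x, hx⟩ := ContinuousMap.setOfIdeal_eq_compl_singleton M
  have hx' : x ∉ ContinuousMap.setOfIdeal M := by rw [hx]; simp
  let g : C(X, ℂ) := ofRealFun ⟨fun y => dist y x, by fun_prop⟩
  have h := ContinuousMap.notMem_setOfIdeal.1 hx' (hle (Ideal.subset_span ⟨g, rfl⟩))
  have h' : ((dist (ψ x) x : ℝ) : ℂ) - ((dist x x : ℝ) : ℂ) = 0 := h
  rw [dist_self, Complex.ofReal_zero, sub_zero, Complex.ofReal_eq_zero, dist_eq_zero] at h'
  exact hψ x h'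

end Dynamics

/-! ### KMS states of the crossed product -/

namespace CrossedProduct

/-- The exponent is `-i · iβ F = βF`: the source of the density in the conformality condition. -/
theorem complexPhase_I_mul_apply {X : Type*} [TopologicalSpace X] (F : C(X, ℝ)) (β : ℝ) (x : X) :
    complexPhase F (Complex.I * β) x = (Real.exp (β * F x) : ℂ) := by
  change Complex.exp _ = _
  push_cast
  congr 1
  linear_combination (-(β : ℂ) * F x) * Complex.I_mul_I

variable {X : Type*} [MetricSpace X] [CompactSpace X] {φ : X ≃ₜ X} {F : C(X, ℝ)} {β : ℝ}

/-- A KMS state vanishes on `f Uⁿ` for `n ≠ 0`. -/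
theorem kmsState_ι_mul_U_zpow [Infinite X] (hφ : IsMinimalHomeo φ)
    {ω : WeakDual ℂ (CrossedProduct φ)} (hω : IsKMSState (flow φ F) β ω) {n : ℤ} (hn : n ≠ 0)
    (f : C(X, ℂ)) :
    ω (ι φ f * ((U φ ^ n : unitary (CrossedProduct φ)) : CrossedProduct φ)) = 0 := by
  have hzero : ∀ g h : C(X, ℂ), ω (ι φ (h * (g.comp ((φ ^ (-n) : X ≃ₜ X) : C(X, X)) - g)) *
      ((U φ ^ n : unitary (CrossedProduct φ)) : CrossedProduct φ)) = 0 := fun g h => by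
    have h1 := hω.apply_mul (flow_add F) (isEntireExtension_ι F g)
      (ι φ h * ((U φ ^ n : unitary (CrossedProduct φ)) : CrossedProduct φ))
    rw [mul_assoc (ι φ h), U_zpow_mul_ι, ← mul_assoc, ← mul_assoc, ← map_mul, ← map_mul] at h1
    rw [mul_sub, map_sub, sub_mul, map_sub, ← h1, mul_comm g h, sub_self]
  have hfix : ∀ x, ((φ ^ (-n) : X ≃ₜ X) : C(X, X)) x ≠ x := hφ.zpow_apply_ne (neg_ne_zero.2 hn)
  have hmem : f ∈ Ideal.span (Set.range fun g : C(X, ℂ) =>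
      g.comp ((φ ^ (-n) : X ≃ₜ X) : C(X, X)) - g) := by
    rw [span_comp_sub_eq_top _ hfix]; trivial
  -- The claim carries an arbitrary multiplier `h` so that coefficients from the ideal are absorbed
  -- into it; `h = 1` gives the result.
  refine Submodule.span_induction (p := fun f _ => ∀ h : C(X, ℂ), ω (ι φ (h * f) *
      ((U φ ^ n : unitary (CrossedProduct φ)) : CrossedProduct φ)) = 0)
    ?_ ?_ ?_ ?_ hmem 1 |> fun h => by rwa [one_mul] at h
  · rintro _ ⟨g, rfl⟩ h
    exact hzero g h
  · intro h; simp
  · intro f g _ _ hf hg h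
    rw [mul_add, map_add, add_mul, map_add, hf, hg, add_zero]
  · intro r f _ hf h
    rw [smul_eq_mul, ← mul_assoc, hf]

variable [MeasurableSpace X] [BorelSpace X]

/-- The functional `a ↦ ∫ E(a) dm`. -/
def stateOfMeasure (φ : X ≃ₜ X) (m : ProbabilityMeasure X) : WeakDual ℂ (CrossedProduct φ) :=
  StrongDual.toWeakDual (LinearMap.mkContinuous
    { toFun := fun a => ∫ x, E φ a x ∂(m : Measure X)
      map_add' := fun a b => by
        simp only [map_add, ContinuousMap.add_apply]
        exact integral_add (integrable_continuousMap _ (E φ a)) (integrable_continuousMap _ (E φ b))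
      map_smul' := fun r a => by
        simp only [map_smul, ContinuousMap.smul_apply]
        exact integral_smul _ _ } 1 fun a => by
      refine (norm_integral_le_of_norm_le_const (ae_of_all _ (norm_E_apply_le a))).trans_eq ?_
      simp)

theorem stateOfMeasure_apply (m : ProbabilityMeasure X) (a : CrossedProduct φ) :
    stateOfMeasure φ m a = ∫ x, E φ a x ∂(m : Measure X) := rfl

theorem isState_stateOfMeasure (m : ProbabilityMeasure X) : IsState (stateOfMeasure φ m) := by
  refine ⟨fun a => ?_, ?_⟩
  · rw [stateOfMeasure_apply]
    have h : ∀ x, E φ (star a * a) x = ((E φ (star a * a) x).re : ℂ) := fun x =>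
      Complex.ext rfl (Complex.nonneg_iff.1 (E_star_mul_self_apply_nonneg a x)).2.symm
    rw [integral_congr_ae (ae_of_all _ h), integral_complex_ofReal]
    exact Complex.zero_le_real.2 (integral_nonneg fun x =>
      (Complex.nonneg_iff.1 (E_star_mul_self_apply_nonneg a x)).1)
  · rw [stateOfMeasure_apply, E_one]
    simp

theorem stateOfMeasure_star (m : ProbabilityMeasure X) (a : CrossedProduct φ) :
    stateOfMeasure φ m (star a) = star (stateOfMeasure φ m a) := by
  rw [stateOfMeasure_apply, stateOfMeasure_apply, E_star]
  exact integral_conj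

/-- The state given by a conformal measure is a KMS state. -/
theorem isKMSState_stateOfMeasure {m : ProbabilityMeasure X} (hm : m ∈ conformalMeasures φ F β) :
    IsKMSState (flow φ F) β (stateOfMeasure φ m) := by
  refine isKMSState_of_dense (flow_add F) (isState_stateOfMeasure m) (stateOfMeasure_star m) ?_
  set D := kmsSubalgebra (flow φ F) β (stateOfMeasure φ m) (stateOfMeasure_star m) with hD
  have hcomm : ∀ (f : C(X, ℂ)) (b : CrossedProduct φ),
      stateOfMeasure φ m (ι φ f * b) = stateOfMeasure φ m (b * ι φ f) := fun f b => by
    rw [stateOfMeasure_apply, stateOfMeasure_apply, E_ι_mul, E_mul_ι, mul_comm]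
  -- Equivariance of `E` turns the left side into the integral of `E(b U) ∘ φ⁻¹`, and conformality
  -- trades `φ⁻¹` for `e^{βF}`.
  have hshift : ∀ b : CrossedProduct φ, stateOfMeasure φ m ((U φ : CrossedProduct φ) * b) =
      stateOfMeasure φ m
        (b * ((U φ : CrossedProduct φ) * ι φ (complexPhase F (Complex.I * β)))) := fun b => by
    rw [stateOfMeasure_apply, stateOfMeasure_apply, ← mul_assoc, E_mul_ι]
    simp only [E_U_mul_apply, ContinuousMap.mul_apply, complexPhase_I_mul_apply]
    rw [mem_conformalMeasures_iff.1 hm]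
    simp only [mul_comm]
  have hιD : ∀ f, ι φ f ∈ D := fun f => ⟨_, isEntireExtension_ι F f, fun _ b => hcomm f b⟩
  have hUD : (U φ : CrossedProduct φ) ∈ D := by
    refine ⟨_, isEntireExtension_U F, fun z b => ?_⟩
    have h : ι φ (complexPhase F (z + Complex.I * β)) =
        ι φ (complexPhase F (Complex.I * β)) * ι φ (complexPhase F z) := by
      rw [add_comm, complexPhase_add, map_mul]
    -- `U` is moved to the right first, then `e^{-izF}`; this leaves `U e^{βF} e^{-izF}`, the
    -- extension at `z + iβ`.
    rw [mul_assoc, hshift, mul_assoc, hcomm, h]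
    simp only [mul_assoc]
  intro a
  refine closed_induction (p := fun a => a ∈ closure (D : Set (CrossedProduct φ)))
    isClosed_closure (fun f => subset_closure (hιD f)) (subset_closure hUD)
    (subset_closure (star_mem hUD)) (fun a b ha hb => ?_) (fun a b ha hb => ?_) a
  · exact map_mem_closure₂ continuous_add ha hb fun _ hc _ hd => add_mem hc hd
  · exact map_mem_closure₂ continuous_mul ha hb fun _ hc _ hd => mul_mem hc hd

/-- A KMS state whose restriction to `C(X)` is given by `m` is `a ↦ ∫ E(a) dm`. -/
theorem kmsState_eq_stateOfMeasure [Infinite X] (hφ : IsMinimalHomeo φ)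
    {ω : WeakDual ℂ (CrossedProduct φ)} (hω : IsKMSState (flow φ F) β ω)
    {m : ProbabilityMeasure X} (hm : ∀ f, ω (ι φ f) = ∫ x, f x ∂(m : Measure X)) :
    ω = stateOfMeasure φ m := by
  refine DFunLike.coe_injective (Continuous.ext_on dense_polynomials ω.continuous
    (stateOfMeasure φ m).continuous fun a ha => ?_)
  refine Submodule.span_induction (p := fun a _ => ω a = stateOfMeasure φ m a) ?_ ?_ ?_ ?_ ha
  · rintro _ ⟨⟨f, n⟩, rfl⟩
    simp only [stateOfMeasure_apply, E_ι_mul_U_zpow]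
    by_cases hn : n = 0
    · subst hn; simp [hm]
    · rw [kmsState_ι_mul_U_zpow hφ hω hn, if_neg hn]; simp
  · simp
  · intro a b _ _ ha hb; rw [map_add, map_add, ha, hb]
  · intro r a _ ha; rw [map_smul, map_smul, ha]

/-- The restriction of a KMS state to `C(X)` is given by a conformal measure. -/
theorem exists_conformalMeasure {ω : WeakDual ℂ (CrossedProduct φ)}
    (hω : IsKMSState (flow φ F) β ω) :
    ∃ m ∈ conformalMeasures φ F β, ∀ f, ω (ι φ f) = ∫ x, f x ∂(m : Measure X) := by
  obtain ⟨m, hm⟩ := exists_probabilityMeasure_of_state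
    ((WeakDual.toStrongDual ω).toLinearMap.comp (ι φ).toAlgHom.toLinearMap)
    (fun f => by
      have h := hω.1.1 (ι φ f)
      rwa [← map_star, ← map_mul] at h)
    (by
      have h := hω.1.2
      rwa [← map_one (ι φ)] at h)
  have hm' : ∀ f, ω (ι φ f) = ∫ x, f x ∂(m : Measure X) := hm
  refine ⟨m, mem_conformalMeasures_iff.2 fun f => ?_, hm'⟩
  -- With `a = U` and `b = f U⋆`, the left side becomes `ω(f ∘ φ⁻¹)` and the right side `ω(f
  -- e^{βF})`.
  have h := hω.apply_mul (flow_add F) (isEntireExtension_U F)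
    (ι φ f * star (U φ : CrossedProduct φ))
  rw [← mul_assoc, U_mul_ι_mul_star, mul_assoc, ← mul_assoc (star _),
    Unitary.star_mul_self_of_mem (U φ).2, one_mul, ← map_mul, hm', hm'] at h
  refine h.trans (integral_congr_ae (ae_of_all _ fun x => ?_))
  simp only [ContinuousMap.mul_apply, complexPhase_I_mul_apply, mul_comm]

/-- The homeomorphism between the KMS states and the conformal measures. -/
def kmsStatesHomeo [Infinite X] (hφ : IsMinimalHomeo φ) (F : C(X, ℝ)) (β : ℝ) :
    kmsStates (flow φ F) β ≃ₜ conformalMeasures φ F β where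
  toFun ω := ⟨(exists_conformalMeasure ω.2).choose, (exists_conformalMeasure ω.2).choose_spec.1⟩
  invFun m := ⟨stateOfMeasure φ m.1, isKMSState_stateOfMeasure m.2⟩
  left_inv ω := Subtype.ext
    (kmsState_eq_stateOfMeasure hφ ω.2 (exists_conformalMeasure ω.2).choose_spec.2).symm
  right_inv m := by
    have hm := exists_conformalMeasure (isKMSState_stateOfMeasure m.2)
    -- The chosen measure is determined by its integrals, and `E` is the identity on `C(X)`.
    refine Subtype.ext (Subtype.ext (measure_ext_of_integral_eq
      (μ := (hm.choose : Measure X)) (ν := (m.1 : Measure X)) fun f => ?_))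
    have h := hm.choose_spec.2 f
    rw [stateOfMeasure_apply, E_ι] at h
    exact h.symm
  continuous_toFun := by
    refine Continuous.subtype_mk ?_ _
    rw [continuous_iff_continuousAt]
    intro ω
    refine (ProbabilityMeasure.tendsto_iff_forall_integral_rclike_tendsto ℂ).2 fun f => ?_
    have h : ∀ ω : kmsStates (flow φ F) β, ∫ x, f x
        ∂((exists_conformalMeasure ω.2).choose : Measure X) = ω.1 (ι φ f.toContinuousMap) :=
      fun ω => ((exists_conformalMeasure ω.2).choose_spec.2 f.toContinuousMap).symm
    simp only [h]
    exact ((WeakDual.eval_continuous _).comp continuous_subtype_val).tendsto ω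
  continuous_invFun := by
    refine Continuous.subtype_mk (WeakDual.continuous_of_continuous_eval fun a => ?_) _
    rw [continuous_iff_continuousAt]
    intro m
    -- `E(a)` is itself a bounded continuous test function.
    exact (ProbabilityMeasure.tendsto_iff_forall_integral_rclike_tendsto ℂ).1
      (continuous_subtype_val.tendsto m) (BoundedContinuousFunction.mkOfCompact (E φ a))

theorem kmsStatesHomeo_integral [Infinite X] (hφ : IsMinimalHomeo φ)
    (ω : kmsStates (flow φ F) β) (f : C(X, ℂ)) :
    ω.1 (ι φ f) = ∫ x, f x ∂((kmsStatesHomeo hφ F β ω).1 : Measure X) :=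
  (exists_conformalMeasure ω.2).choose_spec.2 f

end CrossedProduct

end KMSCrossed
end

/-! ### The main theorem -/

open KMSCrossed
theorem corollary3p9 {X : Type*} [MetricSpace X] [CompactSpace X] [MeasurableSpace X]
    [BorelSpace X] [Infinite X] (φ : X ≃ₜ X) (hφ : IsMinimalHomeo φ) (F : C(X, ℝ))
    (β : ℝ) (hβ : β ≠ 0) :
    Convex ℝ (kmsStates (CrossedProduct.flow φ F) β) ∧
    ∃ Φ : kmsStates (CrossedProduct.flow φ F) β ≃ₜ conformalMeasures φ F β,
      (∀ (ω : kmsStates (CrossedProduct.flow φ F) β) (f : C(X, ℂ)),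
        ω.1 (CrossedProduct.ι φ f) = ∫ x, f x ∂((Φ ω).1 : Measure X)) ∧
      (∀ (ω₁ ω₂ ω₃ : kmsStates (CrossedProduct.flow φ F) β) (s t : ℝ), 0 ≤ s → 0 ≤ t → s + t = 1 →
        ω₃.1 = s • ω₁.1 + t • ω₂.1 →
        ((Φ ω₃).1 : Measure X) =
          ENNReal.ofReal s • ((Φ ω₁).1 : Measure X) +
            ENNReal.ofReal t • ((Φ ω₂).1 : Measure X)) ∧
      (∀ (m : conformalMeasures φ F β) (a : CrossedProduct φ),
        (Φ.symm m).1 a = ∫ x, CrossedProduct.E φ a x ∂(m.1 : Measure X)) := by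
  refine ⟨convex_kmsStates (CrossedProduct.flow_add F) β,
    CrossedProduct.kmsStatesHomeo hφ F β, CrossedProduct.kmsStatesHomeo_integral hφ, ?_,
    fun m a => rfl⟩
  intro ω₁ ω₂ ω₃ s t hs ht _ h
  have hfin : ∀ (r : ℝ) (m : ProbabilityMeasure X),
      IsFiniteMeasure (ENNReal.ofReal r • (m : Measure X)) := fun r m =>
    Measure.smul_finite _ ENNReal.ofReal_ne_top
  have := hfin s
  have := hfin t
  -- Affinity is tested on continuous functions, where integration against the image of `ω` is
  -- evaluation of `ω`.
  refine measure_ext_of_integral_eq fun f => ?_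
  rw [integral_add_measure (integrable_continuousMap _ f) (integrable_continuousMap _ f),
    integral_smul_measure, integral_smul_measure, ENNReal.toReal_ofReal hs,
    ENNReal.toReal_ofReal ht, ← CrossedProduct.kmsStatesHomeo_integral,
    ← CrossedProduct.kmsStatesHomeo_integral, ← CrossedProduct.kmsStatesHomeo_integral, h]
  rfl
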